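/- For $n\in\mathbb{N}$, $n\ge 1$, let $\Omega_n=\{\pm1\}^n$ and let $\mu_n$ be the critical Curie–Weiss measure (inverse temperature $\beta=1$, external field $h=0$) on $\Omega_n$, $$\mu_n(\sigma)=Z_n^{-1}\exp\Big(\frac1n\sum_{1\le i<j\le n}\sigma_i\sigma_j\Big),\qquad Z_n=\sum_{\sigma\in\Omega_n}\exp\Big(\frac1n\sum_{1\le i<j\le n}\sigma_i\sigma_j\Big),$$ and let $W_n=(\sigma_1+\dots+\sigma_n)/n^{3/4}$. Put $$p_1(t)=e^{-t^4/12},\qquad p_2(t)=\Big(\frac{t^2}{2}-\frac{t^6}{30}\Big)e^{-t^4/12},$$ $$F(x)=\frac{\int_{-\infty}^x p_1(t)\,dt}{\int_{-\infty}^\infty p_1(t)\,dt},\qquad G(x)=\frac{\int_x^\infty p_2(t)\,dt}{\int_x^\infty p_1(t)\,dt}-\frac{\int_{-\infty}^\infty p_2(t)\,dt}{\int_{-\infty}^\infty p_1(t)\,dt}.$$ Then: (i) There is an absolute constant $C>0$ such that for all integers $n\ge1$ and all real $x$ with $0\le x\le n^{1/12}$, $$\left|\frac{\mu_n(\sigma: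 W_n>x)}{1-F(x)}-1\right|\le C\,\frac{1+x^6}{\sqrt n}.$$ (ii) For every fixed real number $x$, $$\lim_{n\to\infty}\sqrt n\,\big(\mu_n(\sigma: W_n\le x)-F(x)\big)=(F(x)-1)\,G(x).$$ -/

import Mathlib

open Set Filter Topology MeasureTheory

namespace CurieWeiss

/-- The space of spin configurations `Ω_n = {±1}^n`; the units of `ℤ` are exactly `1` and `-1`. -/
abbrev Config (n : ℕ) : Type := Fin n → ℤˣ

/-- The value `σ_i ∈ {±1}`, as a real number. -/
def spin {n : ℕ} (σ : Config n) (i : Fin n) : ℝ := ((σ i : ℤ) : ℝ)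

/-- The Boltzmann weight `exp ((β / n) ∑_{i < j} σ_i σ_j + β h ∑_i σ_i)`. -/
noncomputable def weight (β h : ℝ) {n : ℕ} (σ : Config n) : ℝ :=
  Real.exp (β / n * ∑ i : Fin n, ∑ j ∈ Finset.Ioi i, spin σ i * spin σ j
    + β * h * ∑ i : Fin n, spin σ i)

/-- The normalizing factor `Z_n`. -/
noncomputable def partitionFunction (β h : ℝ) (n : ℕ) : ℝ :=
  ∑ σ : Config n, weight β h σ

/-- The Boltzmann-Gibbs probability `μ_n(A)` of an event `A ⊆ Ω_n`, where each configuration `σ`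
has mass `Z_n⁻¹ * weight σ`. -/
noncomputable def gibbs (β h : ℝ) (n : ℕ) (A : Set (Config n)) : ℝ :=
  ∑ σ : Config n, A.indicator (fun σ => (partitionFunction β h n)⁻¹ * weight β h σ) σ

/-- The Curie-Weiss measure at the critical point `β = 1`, `h = 0`. -/
noncomputable def criticalGibbs (n : ℕ) (A : Set (Config n)) : ℝ := gibbs 1 0 n A

/-- The total spin `S_n = σ_1 + ⋯ + σ_n`. -/
def totalSpin {n : ℕ} (σ : Config n) : ℝ := ∑ i : Fin n, spin σ i

/-- The rescaled total spin `W_n = S_n / n^{3/4}`. -/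
noncomputable def W {n : ℕ} (σ : Config n) : ℝ := totalSpin σ / (n : ℝ) ^ ((3 : ℝ) / 4)

/-- `p₁(t) = exp (-t⁴ / 12)`. -/
noncomputable def p₁ (t : ℝ) : ℝ := Real.exp (-(t ^ 4 / 12))

/-- `p₂(t) = (t² / 2 - t⁶ / 30) exp (-t⁴ / 12)`. -/
noncomputable def p₂ (t : ℝ) : ℝ := (t ^ 2 / 2 - t ^ 6 / 30) * Real.exp (-(t ^ 4 / 12))

/-- The limiting distribution function, with density proportional to `p₁`. -/
noncomputable def F (x : ℝ) : ℝ := (∫ t in Iic x, p₁ t) / ∫ t, p₁ t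

/-- The coefficient of `n^{-1/2}` in the relative error of the tail probability. -/
noncomputable def G (x : ℝ) : ℝ :=
  (∫ t in Ioi x, p₂ t) / (∫ t in Ioi x, p₁ t) - (∫ t, p₂ t) / ∫ t, p₁ t

end CurieWeiss

namespace CurieWeiss

/-! The configurations of total spin S = 2k - n have total weight proportional to `n.choose k * exp
(S ^ 2 / (2 n))`, so both claims concern these level weights. The logarithm of the ratio of two
consecutive ones is elementary: if v is the midpoint of the two spins and u = v / (n + 1), it equals
2v/n - log ((1 + u) / (1 - u)). Its expansion to fifth order in u is summed exactly by two even
polynomials, `quartic` and `sextic`, so telescoping from the centre takes the place of Stirling's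
formula. At S = n^(3/4) t the exponent is -t^4/12 + n^(-1/2) (t^2/2 - t^6/30) up to smaller terms;
this is where `p₁` and `p₂` come from.

The step function `density` carries the level weights on cells of length 2 n^(-3/4). On the whole
line it differs from `p₁` by at most a constant times n^(-1/2) (1 + t^6) `p₁`
(`IsLocalProfile.abs_sub_le`). Integrated, this bound gives uniform errors; as an integrable
majorant, it gives the limit with `p₂` by dominated convergence. A tail sum differs from the
integral of `density` by at most one cell, a cost of order n^(-3/4).

For (i) the errors must be relative to the tail of `p₁`: `p₁_le_mul_tail` handles the boundary cell
and `setIntegral_poly_mul_p₁_le` the integrated error. For (ii) the first-order expansions of tail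
and total mass are combined in a quotient. -/

/-! ### Two-sided bounds for log ((1 + u) / (1 - u)) -/

theorem le_log_one_add_sub_log_one_sub {u : ℝ} (h0 : 0 ≤ u) (h1 : u < 1) :
    2 * u + 2 * u ^ 3 / 3 + 2 * u ^ 5 / 5 ≤ Real.log (1 + u) - Real.log (1 - u) := by
  have h := Real.sum_range_le_log_div h0 h1 3
  rw [Real.log_div (by linarith) (by linarith)] at h
  norm_num [Finset.sum_range_succ] at h
  linarith

theorem log_one_add_sub_log_one_sub_le {u : ℝ} (h0 : 0 ≤ u) (h1 : u ≤ 1 / 2) :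
    Real.log (1 + u) - Real.log (1 - u)
      ≤ 2 * u + 2 * u ^ 3 / 3 + 2 * u ^ 5 / 5 + 3 * u ^ 7 := by
  have h := Real.log_div_le_sum_range_add h0 (by linarith) 3
  rw [Real.log_div (by linarith) (by linarith)] at h
  norm_num [Finset.sum_range_succ] at h
  have h2 : u ^ 7 / (1 - u ^ 2) ≤ 3 / 2 * u ^ 7 := by
    rw [div_le_iff₀ (by nlinarith)]
    have : 0 ≤ u ^ 7 * (1 / 4 - u ^ 2) := mul_nonneg (by positivity) (by nlinarith)
    nlinarith [pow_nonneg h0 7]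
  linarith

/-! ### Level weights by telescoping from the centre -/

/-- The logarithm of the weight of the level set `{σ | σ_1 + ⋯ + σ_n = 2 k - n}`, up to the
constant `-1 / 2`. -/
noncomputable def logLevel (n k : ℕ) : ℝ :=
  Real.log (n.choose k) + (2 * k - n : ℝ) ^ 2 / (2 * n)

theorem logLevel_symm {n k : ℕ} (hk : k ≤ n) : logLevel n (n - k) = logLevel n k := by
  unfold logLevel
  rw [Nat.choose_symm hk, Nat.cast_sub hk]
  congr 2
  ring

/-- The binomial ratio (n - k) / (k + 1) is (1 - u) / (1 + u) when u is the midpoint spin over n +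
1; this symmetric form leaves only odd powers of u. -/
theorem logLevel_succ {n k : ℕ} (hk : k < n) :
    logLevel n (k + 1) - logLevel n k =
      Real.log (1 - (2 * k + 1 - n) / (n + 1)) - Real.log (1 + (2 * k + 1 - n) / (n + 1))
        + 2 * (2 * k + 1 - n) / n := by
  have hn : (0 : ℝ) < n := by exact_mod_cast (by omega : 0 < n)
  have hkn : (k : ℝ) < n := by exact_mod_cast hk
  have e1 : (1 : ℝ) - (2 * k + 1 - n) / (n + 1) = 2 * (n - k) / (n + 1) := by
    field_simp; ring
  have e2 : (1 : ℝ) + (2 * k + 1 - n) / (n + 1) = 2 * (k + 1) / (n + 1) := by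
    field_simp; ring
  have hc : ((n.choose (k + 1) : ℕ) : ℝ) * (k + 1) = n.choose k * (n - k) := by
    have := Nat.choose_succ_right_eq n k
    rw [← Nat.cast_sub hk.le]
    exact_mod_cast this
  have hp1 : (0 : ℝ) < n.choose (k + 1) := by exact_mod_cast Nat.choose_pos hk
  have hp0 : (0 : ℝ) < n.choose k := by exact_mod_cast Nat.choose_pos hk.le
  have hl := congrArg Real.log hc
  rw [Real.log_mul hp1.ne' (by positivity), Real.log_mul hp0.ne' (by linarith)] at hl
  rw [e1, e2, Real.log_div (by linarith) (by positivity), Real.log_div (by positivity)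
    (by positivity), Real.log_mul (by norm_num) (by linarith), Real.log_mul (by norm_num)
    (by positivity)]
  unfold logLevel
  have : (2 * ((k + 1 : ℕ) : ℝ) - n) ^ 2 / (2 * n) - (2 * k - n : ℝ) ^ 2 / (2 * n)
      = 2 * (2 * k + 1 - n) / n := by
    push_cast; field_simp; ring
  linarith

/-- The quartic approximation to the logarithm of the weight of a level set. -/
noncomputable def quartic (n : ℕ) (S : ℝ) : ℝ :=
  -(S ^ 4 / (12 * (n + 1) ^ 3)) + S ^ 2 * (1 / (6 * (n + 1) ^ 3) + 1 / (2 * n * (n + 1)))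

/-- The sextic correction to `quartic`. -/
noncomputable def sextic (n : ℕ) (S : ℝ) : ℝ :=
  (S ^ 6 - 5 * S ^ 4 + 7 * S ^ 2) / (30 * (n + 1) ^ 5)

/-- The S^2 coefficient of `quartic` is chosen to make this centred difference exact: it supplies
the linear terms and cancels the one produced by S^4. The lower terms of `sextic` play the same
role. -/
theorem quartic_step {n : ℕ} (hn : 1 ≤ n) (v : ℝ) :
    quartic n (v + 1) - quartic n (v - 1) =
      2 * v / n - 2 * (v / (n + 1)) - 2 * (v / (n + 1)) ^ 3 / 3 := by
  have hn : (0 : ℝ) < n := by exact_mod_cast hn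
  unfold quartic
  field_simp
  ring

theorem sextic_step (n : ℕ) (v : ℝ) :
    sextic n (v + 1) - sextic n (v - 1) = 2 * (v / (n + 1)) ^ 5 / 5 := by
  unfold sextic
  field_simp
  ring

/-- The remainder of `logLevel` after subtracting `quartic`. -/
noncomputable def remainder (n k : ℕ) : ℝ := logLevel n k - quartic n (2 * k - n)

theorem remainder_succ {n k : ℕ} (hk : k < n) :
    remainder n (k + 1) - remainder n k =
      -(Real.log (1 + (2 * k + 1 - n) / (n + 1)) - Real.log (1 - (2 * k + 1 - n) / (n + 1))
        - 2 * ((2 * k + 1 - n) / (n + 1)) - 2 * ((2 * k + 1 - n) / (n + 1)) ^ 3 / 3) := by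
  have h1 := logLevel_succ hk
  have h2 := quartic_step (by omega : 1 ≤ n) (2 * k + 1 - n)
  unfold remainder
  have e1 : (2 * ((k + 1 : ℕ) : ℝ) - n) = 2 * k + 1 - n + 1 := by push_cast; ring
  have e2 : (2 * (k : ℝ) - n) = 2 * k + 1 - n - 1 := by ring
  rw [e1, e2]
  linarith

theorem step_bounds {n k : ℕ} (h0 : n ≤ 2 * k) (hk : k < n) :
    0 ≤ (2 * k + 1 - n : ℝ) / (n + 1) ∧ (2 * k + 1 - n : ℝ) / (n + 1) < 1 := by
  have hkn : (k : ℝ) + 1 ≤ n := by exact_mod_cast hk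
  have h0' : (n : ℝ) ≤ 2 * k := by exact_mod_cast h0
  have : (0 : ℝ) ≤ n := by positivity
  refine ⟨div_nonneg (by linarith) (by linarith), ?_⟩
  rw [div_lt_one (by linarith)]
  linarith

/-- To the right of the centre u ≥ 0, so the series of log ((1 + u) / (1 - u)) has nonnegative
terms; cutting it after u^3 or after u^5 fixes the sign of every increment. -/
theorem remainder_le {n k₀ : ℕ} (h0 : n ≤ 2 * k₀) {k : ℕ} (hk₀ : k₀ ≤ k) (hk : k ≤ n) :
    remainder n k ≤ remainder n k₀ ∧
    remainder n k + sextic n (2 * k - n) ≤ remainder n k₀ + sextic n (2 * k₀ - n) := by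
  induction k, hk₀ using Nat.le_induction with
  | base => simp
  | succ k hk₀ ih =>
    have ih := ih (by omega)
    obtain ⟨hu0, hu1⟩ := step_bounds (n := n) (k := k) (by omega) (by omega)
    have hr := remainder_succ (n := n) (k := k) (by omega)
    have hs := sextic_step n (2 * k + 1 - n)
    have hl := le_log_one_add_sub_log_one_sub hu0 hu1
    have e1 : (2 * ((k + 1 : ℕ) : ℝ) - n) = 2 * k + 1 - n + 1 := by push_cast; ring
    have e2 : (2 * (k : ℝ) - n) = 2 * k + 1 - n - 1 := by ring
    rw [e1]
    rw [e2] at ih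
    have := pow_nonneg hu0 5
    constructor <;> linarith

/-- The leftover 3 u^7 of the logarithm is dominated by the increment of S^8 / (n + 1)^7. The
condition on k keeps u ≤ 1/2, where the upper logarithm bound holds. -/
theorem le_remainder {n k₀ : ℕ} (h0 : n ≤ 2 * k₀) {k : ℕ} (hk₀ : k₀ ≤ k) (hk : k ≤ n)
    (hh : 2 * (2 * k - n : ℝ) ≤ n + 1) :
    remainder n k₀ + sextic n (2 * k₀ - n) + (2 * k₀ - n : ℝ) ^ 8 / (n + 1) ^ 7 ≤
      remainder n k + sextic n (2 * k - n) + (2 * k - n : ℝ) ^ 8 / (n + 1) ^ 7 := by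
  induction k, hk₀ using Nat.le_induction with
  | base => simp
  | succ k hk₀ ih =>
    have e1 : (2 * ((k + 1 : ℕ) : ℝ) - n) = 2 * k + 1 - n + 1 := by push_cast; ring
    have e2 : (2 * (k : ℝ) - n) = 2 * k + 1 - n - 1 := by ring
    rw [e1] at hh
    have ih := ih (by omega) (by linarith)
    obtain ⟨hu0, hu1⟩ := step_bounds (n := n) (k := k) (by omega) (by omega)
    have hr := remainder_succ (n := n) (k := k) (by omega)
    have hs := sextic_step n (2 * k + 1 - n)
    have hN : (0 : ℝ) < n + 1 := by positivity
    have hl := log_one_add_sub_log_one_sub_le hu0 (by rw [div_le_iff₀ hN]; linarith)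
    have hkn : (n : ℝ) ≤ 2 * k := by exact_mod_cast (by omega : n ≤ 2 * k)
    have h8 : 3 * ((2 * k + 1 - n : ℝ) / (n + 1)) ^ 7 ≤ (2 * k + 1 - n + 1 : ℝ) ^ 8 / (n + 1) ^ 7
        - (2 * k + 1 - n - 1 : ℝ) ^ 8 / (n + 1) ^ 7 := by
      rw [div_pow, ← sub_div, mul_div_assoc']
      gcongr
      generalize hv : (2 * k + 1 - n : ℝ) = v
      have hv0 : 0 ≤ v := by linarith
      have : (v + 1) ^ 8 - (v - 1) ^ 8 - 3 * v ^ 7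
        = 13 * v ^ 7 + 112 * v ^ 5 + 112 * v ^ 3 + 16 * v := by ring
      have : 0 ≤ 13 * v ^ 7 + 112 * v ^ 5 + 112 * v ^ 3 + 16 * v := by positivity
      linarith
    rw [e1]
    rw [e2] at ih
    linarith

/-- The constant by which the weights of the level sets are normalized. -/
noncomputable def centralFactor (n : ℕ) : ℝ := Real.exp (remainder n ((n + 1) / 2))

theorem centralFactor_pos (n : ℕ) : 0 < centralFactor n := Real.exp_pos _

/-- E is the change of `remainder` from the centre; the left half follows by the reflection k ↦ n -
k. The sign of E holds on the whole range and provides domination, while the sharp estimate is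
confined to |S| ≤ (n + 1) / 2. The term 1 / (n + 1)^5 covers `sextic` at the centre, where S is 0 or
1. -/
theorem exists_choose_mul_exp_eq {n k : ℕ} (hk : k ≤ n) :
    ∃ E ≤ 0, n.choose k * Real.exp ((2 * k - n : ℝ) ^ 2 / (2 * n)) =
        centralFactor n * Real.exp (quartic n (2 * k - n) + E) ∧
      (2 * |(2 * k - n : ℝ)| ≤ n + 1 → |E + sextic n (2 * k - n)| ≤
        (2 * k - n : ℝ) ^ 8 / (n + 1) ^ 7 + 1 / (n + 1) ^ 5) := by
  set k₀ := (n + 1) / 2 with hk₀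
  have hS0 : (0 : ℝ) ≤ 2 * k₀ - n ∧ (2 * k₀ - n : ℝ) ≤ 1 := by
    have h1 : n ≤ 2 * k₀ := by omega
    have h2 : 2 * k₀ ≤ n + 1 := by omega
    have h1' : (n : ℝ) ≤ 2 * k₀ := by exact_mod_cast h1
    have h2' : 2 * (k₀ : ℝ) ≤ n + 1 := by exact_mod_cast h2
    constructor <;> linarith
  have key : ∀ k, k₀ ≤ k → k ≤ n → remainder n k - remainder n k₀ ≤ 0 ∧
      (2 * |(2 * k - n : ℝ)| ≤ n + 1 →
        |remainder n k - remainder n k₀ + sextic n (2 * k - n)| ≤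
        (2 * k - n : ℝ) ^ 8 / (n + 1) ^ 7 + 1 / (n + 1) ^ 5) := by
    intro k h1 h2
    obtain ⟨ha, hb⟩ := remainder_le (by omega) h1 h2
    refine ⟨by linarith, fun hh => ?_⟩
    have hc := le_remainder (by omega) h1 h2 (by linarith [le_abs_self (2 * k - n : ℝ)])
    have hs0 : 0 ≤ sextic n (2 * k₀ - n) ∧ sextic n (2 * k₀ - n) ≤ 1 / (n + 1) ^ 5 := by
      unfold sextic
      set S := (2 * k₀ - n : ℝ)
      have hS2 : S ^ 2 ≤ 1 := by nlinarith
      constructor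
      · apply div_nonneg _ (by positivity)
        nlinarith [sq_nonneg S, mul_nonneg (sq_nonneg S) (sq_nonneg (S ^ 2)),
          mul_nonneg (sq_nonneg S) (sub_nonneg.2 hS2)]
      · rw [div_le_div_iff₀ (by positivity) (by positivity)]
        have : S ^ 6 - 5 * S ^ 4 + 7 * S ^ 2 ≤ 30 := by
          nlinarith [sq_nonneg S, sq_nonneg (S ^ 2), mul_nonneg (sq_nonneg S) (sub_nonneg.2 hS2),
            mul_nonneg (sq_nonneg (S ^ 2)) (sub_nonneg.2 hS2)]
        nlinarith [pow_pos (by positivity : (0 : ℝ) < n + 1) 5]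
    have h8 : 0 ≤ (2 * k₀ - n : ℝ) ^ 8 / (n + 1) ^ 7 := by positivity
    have h8' : 0 ≤ (2 * k - n : ℝ) ^ 8 / (n + 1) ^ 7 := by positivity
    rw [abs_le]
    constructor <;> linarith
  have hexp : ∀ k ≤ n, n.choose k * Real.exp ((2 * k - n : ℝ) ^ 2 / (2 * n))
      = Real.exp (logLevel n k) := by
    intro k hk
    rw [logLevel, Real.exp_add, Real.exp_log (by exact_mod_cast Nat.choose_pos hk)]
  rw [hexp k hk, centralFactor, ← hk₀]
  rcases le_or_gt k₀ k with h | h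
  · refine ⟨remainder n k - remainder n k₀, (key k h hk).1, ?_, (key k h hk).2⟩
    rw [← Real.exp_add, remainder, remainder]
    congr 1
    ring
  · have hs : (2 * ((n - k : ℕ) : ℝ) - n) = -(2 * k - n) := by
      rw [Nat.cast_sub hk]; ring
    obtain ⟨h1, h2⟩ := key (n - k) (by omega) (by omega)
    rw [hs] at h2
    refine ⟨remainder n (n - k) - remainder n k₀, h1, ?_, fun hh => ?_⟩
    · rw [← Real.exp_add, remainder, remainder, logLevel_symm hk, hs]
      have : quartic n (-(2 * k - n)) = quartic n (2 * k - n) := by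
        unfold quartic; ring
      rw [this]
      congr 1
      ring
    · have h2 := h2 (by rwa [abs_neg])
      have e : sextic n (-(2 * k - n)) = sextic n (2 * k - n) := by
        unfold sextic; ring
      rwa [e, Even.neg_pow (by decide)] at h2

/-! ### Local expansion around `p₁` -/

/-- `d` is an approximation of `exp (-t ^ 4 / 12)` on a lattice of mesh `2 z ^ 3`, with an explicit
error in the exponent; the exponent vanishes identically once `1 ≤ |t| z`. -/
def IsLocalProfile (z t d : ℝ) : Prop :=
  (d = 0 ∧ 1 ≤ |t| * z) ∨ ∃ s E : ℝ, |t - s| ≤ 2 * z ^ 3 ∧ |s| * z ≤ 1 ∧ E ≤ 0 ∧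
    d = p₁ t * Real.exp ((t ^ 4 - s ^ 4) / 12
      + z ^ 4 * s ^ 4 * (3 + 3 * z ^ 4 + z ^ 8) / (12 * (1 + z ^ 4) ^ 3)
      + z ^ 2 * s ^ 2 * (z ^ 4 / (6 * (1 + z ^ 4) ^ 3) + 1 / (2 * (1 + z ^ 4))) + E) ∧
    (2 * (|s| * z) ≤ 1 + z ^ 4 →
      |E + z ^ 2 * (s ^ 6 - 5 * s ^ 4 * z ^ 6 + 7 * s ^ 2 * z ^ 12) / (30 * (1 + z ^ 4) ^ 5)| ≤
        z ^ 4 * s ^ 8 / (1 + z ^ 4) ^ 7 + z ^ 20 / (1 + z ^ 4) ^ 5)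

theorem abs_exp_sub_one_le_mul {y B : ℝ} (hy : y ≤ B) (hB : 0 ≤ B) :
    |Real.exp y - 1| ≤ Real.exp B * |y| := by
  have hB1 : 1 ≤ Real.exp B := Real.one_le_exp hB
  rcases le_total 0 y with h | h
  · rw [abs_of_nonneg (by linarith [Real.one_le_exp h]), abs_of_nonneg h]
    have h1 : Real.exp y * (1 - y) ≤ 1 := by
      calc Real.exp y * (1 - y) ≤ Real.exp y * Real.exp (-y) := by
            gcongr; linarith [Real.add_one_le_exp (-y)]
        _ = 1 := by rw [← Real.exp_add]; simp
    have h2 : Real.exp y * y ≤ Real.exp B * y := by gcongr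
    linarith
  · rw [abs_of_nonpos (by linarith [Real.exp_le_one_iff.2 h]), abs_of_nonpos h]
    nlinarith [Real.add_one_le_exp y]

theorem p₁_pos (t : ℝ) : 0 < p₁ t := Real.exp_pos _

theorem add_two_pow_six_le {T : ℝ} (hT : 0 ≤ T) : (T + 2) ^ 6 ≤ 729 * (1 + T ^ 6) := by
  rcases le_total T 1 with h | h
  · calc (T + 2) ^ 6 ≤ (1 + 2) ^ 6 := by gcongr
      _ ≤ 729 * (1 + T ^ 6) := by nlinarith [pow_nonneg hT 6]
  · calc (T + 2) ^ 6 ≤ (3 * T) ^ 6 := by gcongr; linarith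
      _ ≤ 729 * (1 + T ^ 6) := by nlinarith [pow_nonneg hT 6]

theorem abs_pow_four_sub_le {s t e w : ℝ} (h : |t - s| ≤ e) (hs : |s| ≤ w) (ht : |t| ≤ w) :
    |t ^ 4 - s ^ 4| ≤ 4 * e * w ^ 3 := by
  have hw : 0 ≤ w := (abs_nonneg _).trans hs
  have he : 0 ≤ e := (abs_nonneg _).trans h
  have e1 : t ^ 4 - s ^ 4 = (t - s) * (t + s) * (t ^ 2 + s ^ 2) := by ring
  have h2 : |t + s| ≤ 2 * w := (abs_add_le _ _).trans (by linarith)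
  have h3 : |t ^ 2 + s ^ 2| ≤ 2 * w ^ 2 := by
    rw [abs_of_nonneg (by positivity), ← sq_abs t, ← sq_abs s]
    nlinarith [abs_nonneg s, abs_nonneg t]
  rw [e1, abs_mul, abs_mul]
  calc |t - s| * |t + s| * |t ^ 2 + s ^ 2| ≤ e * (2 * w) * (2 * w ^ 2) := by gcongr
    _ = 4 * e * w ^ 3 := by ring

theorem quartic_error_bounds {z s : ℝ} (hz : 0 < z) (hz1 : z ≤ 1) :
    0 ≤ z ^ 4 * s ^ 4 * (3 + 3 * z ^ 4 + z ^ 8) / (12 * (1 + z ^ 4) ^ 3) ∧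
    z ^ 4 * s ^ 4 * (3 + 3 * z ^ 4 + z ^ 8) / (12 * (1 + z ^ 4) ^ 3) ≤ z ^ 4 * |s| ^ 4 ∧
    0 ≤ z ^ 2 * s ^ 2 * (z ^ 4 / (6 * (1 + z ^ 4) ^ 3) + 1 / (2 * (1 + z ^ 4))) ∧
    z ^ 2 * s ^ 2 * (z ^ 4 / (6 * (1 + z ^ 4) ^ 3) + 1 / (2 * (1 + z ^ 4))) ≤ z ^ 2 * |s| ^ 2 := by
  have h4 : z ^ 4 ≤ 1 := pow_le_one₀ hz.le hz1
  have h8 : z ^ 8 ≤ 1 := pow_le_one₀ hz.le hz1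
  have h4' : 0 < z ^ 4 := by positivity
  have hd : 1 ≤ (1 + z ^ 4) ^ 3 := one_le_pow₀ (by linarith)
  rw [Even.pow_abs (by decide), Even.pow_abs (by decide)]
  refine ⟨by positivity, ?_, by positivity, ?_⟩
  · rw [div_le_iff₀ (by positivity)]
    gcongr
    linarith
  · have h1 : z ^ 4 / (6 * (1 + z ^ 4) ^ 3) ≤ 1 / 6 := by
      rw [div_le_div_iff₀ (by positivity) (by norm_num)]; linarith
    have h2 : 1 / (2 * (1 + z ^ 4)) ≤ 1 / 2 := by
      rw [div_le_div_iff₀ (by positivity) (by norm_num)]; linarith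
    have : 0 ≤ z ^ 2 * s ^ 2 := by positivity
    nlinarith

theorem abs_sextic_error_le {z s w : ℝ} (hz : 0 < z) (hz1 : z ≤ 1) (hs : |s| ≤ w) (hw : 1 ≤ w)
    (hsz : |s| * z ≤ 1) :
    |z ^ 2 * (s ^ 6 - 5 * s ^ 4 * z ^ 6 + 7 * s ^ 2 * z ^ 12) / (30 * (1 + z ^ 4) ^ 5)|
      + (z ^ 4 * s ^ 8 / (1 + z ^ 4) ^ 7 + z ^ 20 / (1 + z ^ 4) ^ 5) ≤ 3 * w ^ 6 * z ^ 2 := by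
  have h4' : 0 < z ^ 4 := by positivity
  have hd5 : 1 ≤ (1 + z ^ 4) ^ 5 := one_le_pow₀ (by linarith)
  have hd7 : 1 ≤ (1 + z ^ 4) ^ 7 := one_le_pow₀ (by linarith)
  have hw6 : 1 ≤ w ^ 6 := one_le_pow₀ hw
  have hs6 : s ^ 6 ≤ w ^ 6 := by rw [← Even.pow_abs (by decide) s]; gcongr
  have hs4 : s ^ 4 ≤ w ^ 6 := by
    rw [← Even.pow_abs (by decide) s]
    calc |s| ^ 4 ≤ w ^ 4 := by gcongr
      _ ≤ w ^ 6 := by gcongr; norm_num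
  have hs2 : s ^ 2 ≤ w ^ 6 := by
    rw [← Even.pow_abs (by decide) s]
    calc |s| ^ 2 ≤ w ^ 2 := by gcongr
      _ ≤ w ^ 6 := by gcongr; norm_num
  have h1 : |z ^ 2 * (s ^ 6 - 5 * s ^ 4 * z ^ 6 + 7 * s ^ 2 * z ^ 12) / (30 * (1 + z ^ 4) ^ 5)|
      ≤ w ^ 6 * z ^ 2 := by
    rw [abs_div, abs_mul, abs_of_pos (by positivity : 0 < z ^ 2),
      abs_of_pos (by positivity : 0 < 30 * (1 + z ^ 4) ^ 5), div_le_iff₀ (by positivity)]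
    have a1 : 0 ≤ s ^ 4 * z ^ 6 := by positivity
    have a2 : s ^ 4 * z ^ 6 ≤ w ^ 6 :=
      (mul_le_of_le_one_right (by positivity) (pow_le_one₀ hz.le hz1)).trans hs4
    have a3 : 0 ≤ s ^ 2 * z ^ 12 := by positivity
    have a4 : s ^ 2 * z ^ 12 ≤ w ^ 6 :=
      (mul_le_of_le_one_right (by positivity) (pow_le_one₀ hz.le hz1)).trans hs2
    have a5 : 0 ≤ s ^ 6 := by positivity
    have : |s ^ 6 - 5 * s ^ 4 * z ^ 6 + 7 * s ^ 2 * z ^ 12| ≤ 30 * w ^ 6 := by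
      rw [abs_le]; constructor <;> linarith
    have b : 30 * w ^ 6 ≤ 30 * w ^ 6 * (1 + z ^ 4) ^ 5 :=
      le_mul_of_one_le_right (by positivity) hd5
    calc z ^ 2 * |s ^ 6 - 5 * s ^ 4 * z ^ 6 + 7 * s ^ 2 * z ^ 12|
        ≤ z ^ 2 * (30 * w ^ 6 * (1 + z ^ 4) ^ 5) := by gcongr; linarith
      _ = _ := by ring
  have h2 : z ^ 4 * s ^ 8 / (1 + z ^ 4) ^ 7 ≤ w ^ 6 * z ^ 2 := by
    refine (div_le_self (by positivity) hd7).trans ?_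
    have e : z ^ 4 * s ^ 8 = (|s| * z) ^ 2 * (s ^ 6 * z ^ 2) := by
      rw [mul_pow, sq_abs]; ring
    rw [e]
    calc (|s| * z) ^ 2 * (s ^ 6 * z ^ 2) ≤ 1 * (w ^ 6 * z ^ 2) := by
          gcongr
          exact pow_le_one₀ (by positivity) hsz
      _ = _ := one_mul _
  have h3 : z ^ 20 / (1 + z ^ 4) ^ 5 ≤ w ^ 6 * z ^ 2 := by
    refine (div_le_self (by positivity) hd5).trans ?_
    calc z ^ 20 ≤ z ^ 2 := pow_le_pow_of_le_one hz.le hz1 (by norm_num)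
      _ ≤ _ := le_mul_of_one_le_left (by positivity) hw6
  linarith

/-- In the central region every correction in the exponent is at most a multiple of (|t| + 2)^6 z^2.
Elsewhere |t| + 2 is at least 1 / (2z), so that quantity is at least 1 and the crude bound by e^20
suffices. -/
theorem IsLocalProfile.bounds {z t d : ℝ} (h : IsLocalProfile z t d) (hz : 0 < z)
    (hz1 : z ≤ 1) :
    0 ≤ d ∧ d ≤ Real.exp 20 * p₁ t ∧
      |d - p₁ t| ≤ 7 * Real.exp 20 * ((|t| + 2) ^ 6 * z ^ 2 * p₁ t) := by
  have hp := p₁_pos t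
  have he20 : 1 ≤ Real.exp 20 := Real.one_le_exp (by norm_num)
  have h4' : 0 < z ^ 4 := by positivity
  have h4 : z ^ 4 ≤ 1 := pow_le_one₀ hz.le hz1
  have ht0 := abs_nonneg t
  set w := |t| + 2 with hw
  have hw2 : 2 ≤ w := by linarith
  have hlarge : 1 ≤ w * (2 * z) → 1 ≤ w ^ 6 * z ^ 2 := by
    intro hh
    have h1 : 1 ≤ (w * (2 * z)) ^ 2 := one_le_pow₀ hh
    have h2 : (16 : ℝ) ≤ w ^ 4 := by
      calc (16 : ℝ) = 2 ^ 4 := by norm_num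
        _ ≤ w ^ 4 := by gcongr
    nlinarith [sq_nonneg (w * z)]
  rcases h with ⟨rfl, h⟩ | ⟨s, E, hts, hsz, hE, rfl, hEs⟩
  · have : 1 ≤ w ^ 6 * z ^ 2 := hlarge (by nlinarith)
    refine ⟨le_rfl, by positivity, ?_⟩
    rw [zero_sub, abs_neg, abs_of_pos hp]
    have h3 : p₁ t ≤ w ^ 6 * z ^ 2 * p₁ t := le_mul_of_one_le_left hp.le this
    nlinarith
  · obtain ⟨a0, a1, b0, b1⟩ := quartic_error_bounds (s := s) hz hz1
    set A := z ^ 4 * s ^ 4 * (3 + 3 * z ^ 4 + z ^ 8) / (12 * (1 + z ^ 4) ^ 3)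
    set B := z ^ 2 * s ^ 2 * (z ^ 4 / (6 * (1 + z ^ 4) ^ 3) + 1 / (2 * (1 + z ^ 4)))
    set y := (t ^ 4 - s ^ 4) / 12 + A + B + E with hy
    have z3 : z ^ 3 ≤ 1 := pow_le_one₀ hz.le hz1
    have hst : |s| ≤ |t| + 2 * z ^ 3 := by
      have := abs_sub_abs_le_abs_sub s t
      rw [abs_sub_comm] at this
      linarith
    have hst' : |t| ≤ |s| + 2 * z ^ 3 := by
      have := abs_sub_abs_le_abs_sub t s
      linarith
    have hsw : |s| ≤ w := by linarith
    -- The displacement t - s contributes at most 216/12 = 18, since (|s| + 2) z ≤ 3; the two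
    -- polynomial corrections contribute at most 1 each, and E only lowers y.
    have hyB : y ≤ 20 := by
      have h1 := abs_pow_four_sub_le (w := |s| + 2) hts (by linarith) (by linarith)
      have h2 : 4 * (2 * z ^ 3) * (|s| + 2) ^ 3 ≤ 12 * 18 := by
        have : (|s| + 2) * z ≤ 3 := by linarith
        calc 4 * (2 * z ^ 3) * (|s| + 2) ^ 3 = 8 * ((|s| + 2) * z) ^ 3 := by ring
          _ ≤ 8 * 3 ^ 3 := by gcongr
          _ = _ := by norm_num
      have h3 : z ^ 4 * |s| ^ 4 ≤ 1 := by
        rw [← mul_pow, mul_comm]; exact pow_le_one₀ (by positivity) hsz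
      have h4 : z ^ 2 * |s| ^ 2 ≤ 1 := by
        rw [← mul_pow, mul_comm]; exact pow_le_one₀ (by positivity) hsz
      have := le_abs_self (t ^ 4 - s ^ 4)
      linarith
    have hey : |Real.exp y - 1| ≤ 7 * Real.exp 20 * (w ^ 6 * z ^ 2) := by
      by_cases hc : 2 * (|s| * z) ≤ 1 + z ^ 4
      · refine (abs_exp_sub_one_le_mul hyB (by norm_num)).trans ?_
        have h1 := abs_pow_four_sub_le (w := w) hts hsw (by linarith)
        have h2 := hEs hc
        have h3 := abs_sextic_error_le hz hz1 hsw (by linarith) hsz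
        have h5 : |E| ≤ 3 * w ^ 6 * z ^ 2 := by
          set X := z ^ 2 * (s ^ 6 - 5 * s ^ 4 * z ^ 6 + 7 * s ^ 2 * z ^ 12) / (30 * (1 + z ^ 4) ^ 5)
          have : |E| ≤ |E + X| + |X| := by
            calc |E| = |(E + X) - X| := by ring_nf
              _ ≤ _ := abs_sub _ _
          linarith
        have hz32 : z ^ 3 ≤ z ^ 2 := pow_le_pow_of_le_one hz.le hz1 (by norm_num)
        have hz42 : z ^ 4 ≤ z ^ 2 := pow_le_pow_of_le_one hz.le hz1 (by norm_num)
        have h6 : 4 * (2 * z ^ 3) * w ^ 3 ≤ 8 * (w ^ 6 * z ^ 2) := by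
          have : w ^ 3 ≤ w ^ 6 := pow_le_pow_right₀ (by linarith) (by norm_num)
          calc 4 * (2 * z ^ 3) * w ^ 3 ≤ 4 * (2 * z ^ 2) * w ^ 6 := by gcongr
            _ = _ := by ring
        have h7 : z ^ 4 * |s| ^ 4 ≤ w ^ 6 * z ^ 2 := by
          calc z ^ 4 * |s| ^ 4 ≤ z ^ 2 * w ^ 4 := by gcongr
            _ ≤ z ^ 2 * w ^ 6 := by
              gcongr
              · linarith
              · norm_num
            _ = _ := by ring
        have h8 : z ^ 2 * |s| ^ 2 ≤ w ^ 6 * z ^ 2 := by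
          calc z ^ 2 * |s| ^ 2 ≤ z ^ 2 * w ^ 2 := by gcongr
            _ ≤ z ^ 2 * w ^ 6 := by
              gcongr
              · linarith
              · norm_num
            _ = _ := by ring
        have h9 : |y| ≤ 7 * (w ^ 6 * z ^ 2) := by
          have := abs_le.1 h1
          have := abs_le.1 h5
          rw [abs_le]
          constructor <;> linarith
        calc Real.exp 20 * |y| ≤ Real.exp 20 * (7 * (w ^ 6 * z ^ 2)) := by gcongr
          _ = _ := by ring
      · have h1 : 1 ≤ w ^ 6 * z ^ 2 := by
          apply hlarge
          have : z ^ 3 * z = z ^ 4 := by ring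
          nlinarith
        have h2 : |Real.exp y - 1| ≤ Real.exp 20 := by
          have := Real.exp_pos y
          have := Real.exp_le_exp.2 hyB
          rw [abs_le]
          constructor <;> linarith
        nlinarith
    refine ⟨by positivity, ?_, ?_⟩
    · rw [mul_comm]
      gcongr
    · have : p₁ t * Real.exp y - p₁ t = p₁ t * (Real.exp y - 1) := by ring
      rw [this, abs_mul, abs_of_pos hp]
      calc p₁ t * |Real.exp y - 1| ≤ p₁ t * (7 * Real.exp 20 * (w ^ 6 * z ^ 2)) := by gcongr
        _ = _ := by ring

/-- The constant in the first order comparison with `p₁`. -/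
noncomputable def profileConst : ℝ := 5103 * Real.exp 20

theorem profileConst_pos : 0 < profileConst := by unfold profileConst; positivity

theorem IsLocalProfile.abs_sub_le {z t d : ℝ} (h : IsLocalProfile z t d) (hz : 0 < z)
    (hz1 : z ≤ 1) : |d - p₁ t| ≤ profileConst * z ^ 2 * ((1 + t ^ 6) * p₁ t) := by
  have h1 := (h.bounds hz hz1).2.2
  have h2 := add_two_pow_six_le (abs_nonneg t)
  rw [Even.pow_abs (by decide)] at h2
  have hp := p₁_pos t
  calc |d - p₁ t| ≤ 7 * Real.exp 20 * ((|t| + 2) ^ 6 * z ^ 2 * p₁ t) := h1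
    _ ≤ 7 * Real.exp 20 * (729 * (1 + t ^ 6) * z ^ 2 * p₁ t) := by gcongr
    _ = _ := by unfold profileConst; ring

theorem tendsto_exp_sub_one_div {α : Type*} {l : Filter α} {z w : α → ℝ} {L : ℝ}
    (hz : Tendsto z l (𝓝 0)) (hz0 : ∀ᶠ i in l, z i ≠ 0) (hw : Tendsto w l (𝓝 L)) :
    Tendsto (fun i => (Real.exp (z i ^ 2 * w i) - 1) / z i ^ 2) l (𝓝 L) := by
  have hy : Tendsto (fun i => z i ^ 2 * w i) l (𝓝 0) := by
    simpa using (hz.pow 2).mul hw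
  have hb : Tendsto (fun i => z i ^ 2 * w i ^ 2) l (𝓝 0) := by
    simpa using (hz.pow 2).mul (hw.pow 2)
  have hd : Tendsto (fun i => (Real.exp (z i ^ 2 * w i) - 1) / z i ^ 2 - w i) l (𝓝 0) := by
    refine squeeze_zero_norm' ?_ hb
    have h1 : ∀ᶠ i in l, |z i ^ 2 * w i| ≤ 1 := by
      have := hy.abs
      rw [abs_zero] at this
      exact this.eventually_le_const one_pos
    filter_upwards [h1, hz0] with i h1 h0
    have h2 := Real.abs_exp_sub_one_sub_id_le h1
    have hp : 0 < z i ^ 2 := by positivity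
    have e : (Real.exp (z i ^ 2 * w i) - 1) / z i ^ 2 - w i
        = (Real.exp (z i ^ 2 * w i) - 1 - z i ^ 2 * w i) / z i ^ 2 := by
      field_simp
    rw [e, Real.norm_eq_abs, abs_div, abs_of_pos hp, div_le_iff₀ hp]
    linarith
  simpa using hd.add hw

/-- After division by z^2 the displacement t - s, of order z^3, disappears; the quadratic correction
leaves t^2/2, and E leaves -t^6/30 because its error is of order z^4. The alternative d = 0 is
eventually excluded, as |t| z tends to 0. -/
theorem tendsto_of_isLocalProfile {α : Type*} {l : Filter α} [l.NeBot] {z d : α → ℝ} {t : ℝ}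
    (hz : Tendsto z l (𝓝 0)) (hz0 : ∀ᶠ i in l, 0 < z i)
    (h : ∀ᶠ i in l, IsLocalProfile (z i) t (d i)) :
    Tendsto (fun i => (d i - p₁ t) / z i ^ 2) l (𝓝 (p₂ t)) := by
  have hsmall : ∀ᶠ i in l, |t| * z i < 1 := by
    have : Tendsto (fun i => |t| * z i) l (𝓝 0) := by simpa using hz.const_mul |t|
    exact this.eventually_lt_const one_pos
  have hex : ∀ᶠ i in l, ∃ p : ℝ × ℝ, |t - p.1| ≤ 2 * z i ^ 3 ∧
      d i = p₁ t * Real.exp ((t ^ 4 - p.1 ^ 4) / 12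
      + z i ^ 4 * p.1 ^ 4 * (3 + 3 * z i ^ 4 + z i ^ 8) / (12 * (1 + z i ^ 4) ^ 3)
      + z i ^ 2 * p.1 ^ 2 * (z i ^ 4 / (6 * (1 + z i ^ 4) ^ 3) + 1 / (2 * (1 + z i ^ 4))) + p.2) ∧
    (2 * (|p.1| * z i) ≤ 1 + z i ^ 4 →
      |p.2 + z i ^ 2 * (p.1 ^ 6 - 5 * p.1 ^ 4 * z i ^ 6 + 7 * p.1 ^ 2 * z i ^ 12)
        / (30 * (1 + z i ^ 4) ^ 5)| ≤
        z i ^ 4 * p.1 ^ 8 / (1 + z i ^ 4) ^ 7 + z i ^ 20 / (1 + z i ^ 4) ^ 5) := by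
    filter_upwards [hsmall, h] with i h1 h2
    rcases h2 with ⟨-, h2⟩ | ⟨s, E, h3, -, -, h4, h5⟩
    · linarith
    · exact ⟨(s, E), h3, h4, h5⟩
  obtain ⟨p, hp⟩ := hex.choice
  set s := fun i => (p i).1 with hs
  set E := fun i => (p i).2 with hE
  have hst : Tendsto s l (𝓝 t) := by
    rw [tendsto_iff_norm_sub_tendsto_zero]
    have h0 : Tendsto (fun i => 2 * z i ^ 3) l (𝓝 0) := by simpa using (hz.pow 3).const_mul 2
    refine squeeze_zero' (Eventually.of_forall fun _ => norm_nonneg _) ?_ h0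
    filter_upwards [hp] with i hi
    rw [Real.norm_eq_abs, abs_sub_comm]
    exact hi.1
  have hcond : ∀ᶠ i in l, 2 * (|s i| * z i) ≤ 1 + z i ^ 4 := by
    have : Tendsto (fun i => 2 * (|s i| * z i)) l (𝓝 0) := by
      simpa using (hst.abs.mul hz).const_mul 2
    filter_upwards [this.eventually_lt_const one_pos] with i hi
    have : 0 ≤ z i ^ 4 := by positivity
    linarith
  have hden : ∀ k : ℕ, Tendsto (fun i => (1 + z i ^ 4) ^ k) l (𝓝 1) := fun k => by
    simpa using ((hz.pow 4).const_add 1).pow k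
  have hq : Tendsto (fun i => (t ^ 4 - s i ^ 4) / 12 / z i ^ 2) l (𝓝 0) := by
    have h0 : Tendsto (fun i => 2 * z i * (|t + s i| * (t ^ 2 + s i ^ 2))) l (𝓝 0) := by
      simpa using (hz.const_mul 2).mul ((hst.const_add t).abs.mul ((hst.pow 2).const_add (t ^ 2)))
    refine squeeze_zero_norm' ?_ h0
    filter_upwards [hp, hz0] with i hi h0
    have e : t ^ 4 - s i ^ 4 = (t - s i) * ((t + s i) * (t ^ 2 + s i ^ 2)) := by ring
    rw [div_div, e, Real.norm_eq_abs, abs_div, abs_mul, abs_mul,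
      abs_of_nonneg (by positivity : 0 ≤ t ^ 2 + s i ^ 2),
      abs_of_pos (by positivity : 0 < 12 * z i ^ 2), div_le_iff₀ (by positivity)]
    have hX : 0 ≤ |t + s i| * (t ^ 2 + s i ^ 2) := by positivity
    calc |t - s i| * (|t + s i| * (t ^ 2 + s i ^ 2))
        ≤ 2 * z i ^ 3 * (|t + s i| * (t ^ 2 + s i ^ 2)) := by gcongr; exact hi.1
      _ ≤ 12 * (2 * z i ^ 3 * (|t + s i| * (t ^ 2 + s i ^ 2))) := by
        have : 0 ≤ 2 * z i ^ 3 * (|t + s i| * (t ^ 2 + s i ^ 2)) := by positivity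
        linarith
      _ = _ := by ring
  have hA : Tendsto (fun i => z i ^ 2 * s i ^ 4 * (3 + 3 * z i ^ 4 + z i ^ 8)
      / (12 * (1 + z i ^ 4) ^ 3)) l (𝓝 0) := by
    have := ((((hz.pow 2).mul (hst.pow 4)).mul ((((hz.pow 4).const_mul 3).const_add 3).add
      (hz.pow 8))).div ((hden 3).const_mul 12) (by norm_num))
    simpa [Pi.div_def] using this
  have hB : Tendsto (fun i => s i ^ 2 * (z i ^ 4 / (6 * (1 + z i ^ 4) ^ 3)
      + 1 / (2 * (1 + z i ^ 4)))) l (𝓝 (t ^ 2 / 2)) := by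
    have := (hst.pow 2).mul (((hz.pow 4).div ((hden 3).const_mul 6) (by norm_num)).add
      ((tendsto_const_nhds (x := (1 : ℝ))).div ((hden 1).const_mul 2) (by norm_num)))
    simpa [div_eq_mul_inv] using this
  have hX : Tendsto (fun i => (s i ^ 6 - 5 * s i ^ 4 * z i ^ 6 + 7 * s i ^ 2 * z i ^ 12)
      / (30 * (1 + z i ^ 4) ^ 5)) l (𝓝 (t ^ 6 / 30)) := by
    have := ((((hst.pow 6).sub (((hst.pow 4).const_mul 5).mul (hz.pow 6))).add
      (((hst.pow 2).const_mul 7).mul (hz.pow 12))).div ((hden 5).const_mul 30) (by norm_num))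
    simpa [Pi.div_def] using this
  have hEX : Tendsto (fun i => E i / z i ^ 2
      + (s i ^ 6 - 5 * s i ^ 4 * z i ^ 6 + 7 * s i ^ 2 * z i ^ 12)
      / (30 * (1 + z i ^ 4) ^ 5)) l (𝓝 0) := by
    have h0 : Tendsto (fun i => z i ^ 2 * s i ^ 8 / (1 + z i ^ 4) ^ 7
        + z i ^ 18 / (1 + z i ^ 4) ^ 5) l (𝓝 0) := by
      have := (((hz.pow 2).mul (hst.pow 8)).div (hden 7) (by norm_num)).add
        ((hz.pow 18).div (hden 5) (by norm_num))
      simpa using this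
    refine squeeze_zero_norm' ?_ h0
    filter_upwards [hp, hz0, hcond] with i hi h0 hc
    have h5 := hi.2.2 hc
    have hz2 : 0 < z i ^ 2 := by positivity
    rw [Real.norm_eq_abs, ← mul_le_mul_iff_of_pos_right hz2]
    have habs : ∀ Y : ℝ, |Y| * z i ^ 2 = |Y * z i ^ 2| := fun Y => by
      rw [abs_mul, abs_of_pos hz2]
    have e1 : (E i / z i ^ 2 + (s i ^ 6 - 5 * s i ^ 4 * z i ^ 6 + 7 * s i ^ 2 * z i ^ 12)
        / (30 * (1 + z i ^ 4) ^ 5)) * z i ^ 2 = E i + z i ^ 2 *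
        (s i ^ 6 - 5 * s i ^ 4 * z i ^ 6 + 7 * s i ^ 2 * z i ^ 12) / (30 * (1 + z i ^ 4) ^ 5) := by
      rw [add_mul, div_mul_cancel₀ _ hz2.ne']
      ring
    rw [habs, e1]
    refine h5.trans_eq ?_
    simp only [hs]
    ring
  have hw : Tendsto (fun i => (t ^ 4 - s i ^ 4) / 12 / z i ^ 2
      + z i ^ 2 * s i ^ 4 * (3 + 3 * z i ^ 4 + z i ^ 8) / (12 * (1 + z i ^ 4) ^ 3)
      + s i ^ 2 * (z i ^ 4 / (6 * (1 + z i ^ 4) ^ 3) + 1 / (2 * (1 + z i ^ 4)))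
      + E i / z i ^ 2) l (𝓝 (t ^ 2 / 2 - t ^ 6 / 30)) := by
    have := ((hq.add hA).add hB).add (hEX.sub hX)
    simpa [sub_eq_add_neg] using this
  have hfin := (tendsto_exp_sub_one_div hz (hz0.mono fun _ h => h.ne') hw).const_mul (p₁ t)
  have hlim : p₁ t * (t ^ 2 / 2 - t ^ 6 / 30) = p₂ t := mul_comm _ _
  rw [hlim] at hfin
  refine hfin.congr' ?_
  filter_upwards [hp, hz0] with i hi h0
  rw [hi.2.1]
  have : z i ^ 2 * ((t ^ 4 - s i ^ 4) / 12 / z i ^ 2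
      + z i ^ 2 * s i ^ 4 * (3 + 3 * z i ^ 4 + z i ^ 8) / (12 * (1 + z i ^ 4) ^ 3)
      + s i ^ 2 * (z i ^ 4 / (6 * (1 + z i ^ 4) ^ 3) + 1 / (2 * (1 + z i ^ 4)))
      + E i / z i ^ 2) = (t ^ 4 - s i ^ 4) / 12
      + z i ^ 4 * s i ^ 4 * (3 + 3 * z i ^ 4 + z i ^ 8) / (12 * (1 + z i ^ 4) ^ 3)
      + z i ^ 2 * s i ^ 2 * (z i ^ 4 / (6 * (1 + z i ^ 4) ^ 3) + 1 / (2 * (1 + z i ^ 4)))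
      + E i := by
    have e2 : z i ^ 2 * ((t ^ 4 - s i ^ 4) / 12 / z i ^ 2) = (t ^ 4 - s i ^ 4) / 12 := by
      field_simp
    have e3 : z i ^ 2 * (E i / z i ^ 2) = E i := by field_simp
    rw [mul_add, mul_add, mul_add, e2, e3]
    ring
  rw [this]
  ring

/-! ### The scale and the step density -/

/-- The scale `n ^ (-1 / 4)`. -/
noncomputable def scale (n : ℕ) : ℝ := (n : ℝ) ^ (-(1 / 4) : ℝ)

theorem scale_pos {n : ℕ} (hn : 1 ≤ n) : 0 < scale n :=
  Real.rpow_pos_of_pos (by exact_mod_cast hn) _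

theorem scale_le_one {n : ℕ} (hn : 1 ≤ n) : scale n ≤ 1 :=
  Real.rpow_le_one_of_one_le_of_nonpos (by exact_mod_cast hn) (by norm_num)

theorem scale_pow (n k : ℕ) : scale n ^ k = (n : ℝ) ^ (-(k / 4) : ℝ) := by
  rw [scale, ← Real.rpow_natCast, ← Real.rpow_mul (by positivity)]
  congr 1
  ring

theorem scale_pow_four (n : ℕ) : scale n ^ 4 = (n : ℝ)⁻¹ := by
  rw [scale_pow]
  norm_num [Real.rpow_neg_one]

theorem scale_sq (n : ℕ) : scale n ^ 2 = (√(n : ℝ))⁻¹ := by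
  rw [scale_pow, Real.sqrt_eq_rpow, ← Real.rpow_neg (by positivity)]
  norm_num

theorem scale_cube (n : ℕ) : scale n ^ 3 = ((n : ℝ) ^ ((3 : ℝ) / 4))⁻¹ := by
  rw [scale_pow, ← Real.rpow_neg (by positivity)]
  norm_num

theorem tendsto_scale : Tendsto scale atTop (𝓝 0) :=
  (tendsto_rpow_neg_atTop (by norm_num : (0 : ℝ) < 1 / 4)).comp tendsto_natCast_atTop_atTop

/-- The value of `W` on the level set `{σ | σ_1 + ⋯ + σ_n = 2 k - n}`. -/
noncomputable def node (n k : ℕ) : ℝ := (2 * k - n) * scale n ^ 3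

/-- The normalized weight of the level set `{σ | σ_1 + ⋯ + σ_n = 2 k - n}`. -/
noncomputable def level (n k : ℕ) : ℝ :=
  n.choose k * Real.exp ((2 * k - n : ℝ) ^ 2 / (2 * n)) / centralFactor n

theorem level_nonneg (n k : ℕ) : 0 ≤ level n k :=
  div_nonneg (by positivity) (centralFactor_pos n).le

theorem isLocalProfile_level {n k : ℕ} (hn : 1 ≤ n) (hk : k ≤ n) {t : ℝ}
    (ht : t ∈ Ico (node n k) (node n k + 2 * scale n ^ 3)) :
    IsLocalProfile (scale n) t (level n k) := by
  obtain ⟨E, hE, h1, h2⟩ := exists_choose_mul_exp_eq hk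
  have hz := scale_pos hn
  have h4 := scale_pow_four n
  have hn0 : (0 : ℝ) < n := by exact_mod_cast hn
  have hk' : (k : ℝ) ≤ n := by exact_mod_cast hk
  have hk0 : (0 : ℝ) ≤ k := by positivity
  set z := scale n
  have hnz : (n : ℝ) = 1 / z ^ 4 := by rw [h4]; simp
  set S := (2 * k - n : ℝ) with hS
  have hs : node n k = S * z ^ 3 := rfl
  have hSs : S = node n k / z ^ 3 := by rw [hs]; field_simp
  set s := node n k
  have habs : |S| ≤ n := by rw [abs_le]; constructor <;> linarith
  have hSabs : |S| = |s| / z ^ 3 := by rw [hSs, abs_div, abs_of_pos (by positivity : 0 < z ^ 3)]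
  refine Or.inr ⟨s, E, ?_, ?_, hE, ?_, ?_⟩
  · rw [abs_of_nonneg (by linarith [ht.1])]
    linarith [ht.2]
  · rw [hSabs, hnz, div_le_div_iff₀ (by positivity) (by positivity)] at habs
    have : 0 < z ^ 3 := by positivity
    nlinarith
  · rw [level, h1, mul_div_cancel_left₀ _ (centralFactor_pos n).ne', p₁, ← Real.exp_add]
    congr 1
    rw [quartic, hSs, hnz]
    field_simp
    ring
  · intro hc
    have hc' : 2 * |S| ≤ n + 1 := by
      rw [hSabs, hnz]
      have : 1 / z ^ 4 + 1 = (1 + z ^ 4) / z ^ 4 := by field_simp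
      rw [this, mul_div_assoc', div_le_div_iff₀ (by positivity) (by positivity)]
      have : 0 < z ^ 3 := by positivity
      nlinarith
    convert h2 hc' using 1
    · congr 2
      rw [sextic, hSs, hnz]
      field_simp
    · rw [hSs, hnz]
      field_simp

/-- The step function taking the value `level n k` on the cell starting at `node n k`. -/
noncomputable def density (n : ℕ) (t : ℝ) : ℝ :=
  ∑ k ∈ Finset.range (n + 1),
    (Ico (node n k) (node n k + 2 * scale n ^ 3)).indicator (fun _ => level n k) t

/-- The cells are disjoint and cover |t| < n z^3 = 1/z, where z is the scale. Off the cells the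
density is 0 and |t| z ≥ 1, the first alternative of the profile. -/
theorem isLocalProfile_density {n : ℕ} (hn : 1 ≤ n) (t : ℝ) :
    IsLocalProfile (scale n) t (density n t) := by
  have hz := scale_pos hn
  have hz3 : 0 < scale n ^ 3 := by positivity
  by_cases h : ∃ k ≤ n, t ∈ Ico (node n k) (node n k + 2 * scale n ^ 3)
  · obtain ⟨k, hk, ht⟩ := h
    have : density n t = level n k := by
      rw [density, Finset.sum_eq_single k]
      · exact indicator_of_mem ht _
      · intro j _ hj
        refine indicator_of_notMem (fun htj => hj ?_) _
        have h1 : (j : ℝ) < k + 1 := by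
          have := htj.1.trans_lt ht.2
          unfold node at this
          nlinarith
        have h2 : (k : ℝ) < j + 1 := by
          have := ht.1.trans_lt htj.2
          unfold node at this
          nlinarith
        have h1' : j < k + 1 := by exact_mod_cast h1
        have h2' : k < j + 1 := by exact_mod_cast h2
        omega
      · intro hk'
        exact absurd (Finset.mem_range.2 (by omega)) hk'
    rw [this]
    exact isLocalProfile_level hn hk ht
  · push Not at h
    refine Or.inl ⟨Finset.sum_eq_zero fun k hk => indicator_of_notMem
      (h k (by simpa [Nat.lt_succ_iff] using hk)) _, ?_⟩
    have h4 := scale_pow_four n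
    have hn0 : (0 : ℝ) < n := by exact_mod_cast hn
    have hnz : (n : ℝ) * scale n ^ 4 = 1 := by rw [h4]; field_simp
    by_contra! hlt
    have hlt' : |t| < n * scale n ^ 3 := by
      have : n * scale n ^ 3 * scale n = 1 := by rw [← hnz]; ring
      exact lt_of_mul_lt_mul_right (by rwa [this]) hz.le
    rw [abs_lt] at hlt'
    -- u is the real index whose node would be t, so its floor indexes the cell containing t.
    set u := (t / scale n ^ 3 + n) / 2 with hu
    have htu : t = (2 * u - n) * scale n ^ 3 := by rw [hu]; field_simp; ring
    have hu0 : 0 ≤ u := by nlinarith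
    have hun : u ≤ n := by nlinarith
    have hf1 := Nat.floor_le hu0
    have hf2 := Nat.lt_floor_add_one u
    refine h ⌊u⌋₊ (Nat.floor_le_of_le hun) ⟨?_, ?_⟩
    · rw [htu]; unfold node; gcongr
    · rw [htu]; unfold node; nlinarith

theorem integrable_density (n : ℕ) : Integrable (density n) := by
  unfold density
  refine integrable_finsetSum _ fun k _ => ?_
  exact (integrable_indicator_iff measurableSet_Ico).2 (integrableOn_const measure_Ico_lt_top.ne)

theorem setIntegral_density (n : ℕ) (s : Set ℝ) :
    ∫ t in s, density n t = ∑ k ∈ Finset.range (n + 1),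
      level n k * volume.real (Ico (node n k) (node n k + 2 * scale n ^ 3) ∩ s) := by
  unfold density
  rw [integral_finsetSum]
  · refine Finset.sum_congr rfl fun k _ => ?_
    rw [integral_indicator measurableSet_Ico, setIntegral_const, smul_eq_mul, mul_comm,
      measureReal_restrict_apply measurableSet_Ico]
  · intro k _
    exact ((integrable_indicator_iff measurableSet_Ico).2 (integrableOn_const measure_Ico_lt_top.ne)).integrableOn

theorem integral_density (n : ℕ) (hz : 0 ≤ scale n) :
    ∫ t, density n t = 2 * scale n ^ 3 * ∑ k ∈ Finset.range (n + 1), level n k := by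
  have h := setIntegral_density n univ
  rw [setIntegral_univ] at h
  rw [h, Finset.mul_sum]
  refine Finset.sum_congr rfl fun k _ => ?_
  rw [inter_univ, Real.volume_real_Ico_of_le (by linarith [pow_nonneg hz 3])]
  ring

/-- Cells begin at their nodes, so a cell whose node exceeds x lies entirely in the tail. Only a
cell containing x can enter the integral without entering the sum, and it adds at most its length
times the density at x. -/
theorem abs_setIntegral_density_sub_le (n : ℕ) (hz : 0 ≤ scale n) (x : ℝ) :
    |(∫ t in Ioi x, density n t) - 2 * scale n ^ 3 * ∑ k ∈ Finset.range (n + 1),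
      (if x < node n k then level n k else 0)| ≤ 2 * scale n ^ 3 * density n x := by
  have hh : 0 ≤ 2 * scale n ^ 3 := by positivity
  rw [setIntegral_density n (Ioi x), density, Finset.mul_sum, Finset.mul_sum,
    ← Finset.sum_sub_distrib]
  refine (Finset.abs_sum_le_sum_abs _ _).trans (Finset.sum_le_sum fun k _ => ?_)
  have hl := level_nonneg n k
  generalize 2 * scale n ^ 3 = h at *
  generalize node n k = a
  generalize level n k = L at *
  by_cases h1 : x < a
  · have e1 : Ico a (a + h) ∩ Ioi x = Ico a (a + h) :=
      inter_eq_left.2 fun y hy => h1.trans_le hy.1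
    have e2 : x ∉ Ico a (a + h) := fun hx => absurd hx.1 (not_le.2 h1)
    rw [e1, Real.volume_real_Ico_of_le (by linarith), if_pos h1, indicator_of_notMem e2]
    rw [add_sub_cancel_left, mul_comm, sub_self, abs_zero, mul_zero]
  · rw [if_neg h1, mul_zero, sub_zero, abs_of_nonneg (by positivity)]
    by_cases h2 : x < a + h
    · have e2 : x ∈ Ico a (a + h) := ⟨not_lt.1 h1, h2⟩
      rw [indicator_of_mem e2, mul_comm]
      gcongr
      calc volume.real (Ico a (a + h) ∩ Ioi x) ≤ volume.real (Ico a (a + h)) :=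
            measureReal_mono inter_subset_left (by simp)
        _ = h := by rw [Real.volume_real_Ico_of_le (by linarith)]; ring
    · have e1 : Ico a (a + h) ∩ Ioi x = ∅ := by
        ext y
        simp only [mem_inter_iff, mem_Ico, mem_Ioi, mem_empty_iff_false, iff_false]
        intro hy
        linarith [hy.1.2, hy.2]
      have e2 : x ∉ Ico a (a + h) := fun hx => h2 hx.2
      rw [e1, indicator_of_notMem e2]
      simp

/-! ### Reduction of the Gibbs measure to level sums -/

theorem sum_config (n : ℕ) (f : ℝ → ℝ) :
    ∑ σ : Config n, f (totalSpin σ) =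
      ∑ k ∈ Finset.range (n + 1), n.choose k * f (2 * k - n) := by
  have h1 : ∑ σ : Config n, f (totalSpin σ) =
      ∑ s ∈ (Finset.univ : Finset (Fin n)).powerset, f (2 * s.card - n) := by
    refine Finset.sum_bij' (fun σ _ => Finset.univ.filter fun i => σ i = 1)
      (fun s _ i => if i ∈ s then 1 else -1) ?_ ?_ ?_ ?_ ?_
    · simp
    · simp
    · intro σ _
      ext i
      rcases Int.units_eq_one_or (σ i) with h | h <;> simp [h]
    · intro s _
      ext i
      simp only [Finset.mem_filter, Finset.mem_univ, true_and]
      by_cases h : i ∈ s <;> simp [h]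
    · intro σ _
      congr 1
      have h2 : ∀ i, spin σ i = 2 * (if σ i = 1 then 1 else 0) - 1 := by
        intro i
        unfold spin
        rcases Int.units_eq_one_or (σ i) with h | h <;> norm_num [h]
      simp only [totalSpin, h2]
      rw [Finset.sum_sub_distrib, ← Finset.mul_sum, Finset.sum_boole]
      simp
  rw [h1, Finset.sum_powerset_apply_card (fun k : ℕ => f (2 * k - n))]
  simp

theorem spin_mul_self {n : ℕ} (σ : Config n) (i : Fin n) : spin σ i * spin σ i = 1 := by
  unfold spin
  rcases Int.units_eq_one_or (σ i) with h | h <;> norm_num [h]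

theorem sum_pairs_eq {n : ℕ} (σ : Config n) :
    ∑ i : Fin n, ∑ j ∈ Finset.Ioi i, spin σ i * spin σ j = (totalSpin σ ^ 2 - n) / 2 := by
  have h := Finset.sum_sum_Ioi_add_eq_sum_sum_off_diag (fun i j => spin σ i * spin σ j)
  have h1 : ∀ i j : Fin n, spin σ j * spin σ i + spin σ i * spin σ j
      = 2 * (spin σ i * spin σ j) := fun i j => by ring
  simp only [h1] at h
  have h2 : ∑ i : Fin n, ∑ j ∈ {i}ᶜ, spin σ j * spin σ i = totalSpin σ ^ 2 - n := by
    have h3 : ∀ i : Fin n, ∑ j ∈ {i}ᶜ, spin σ j = totalSpin σ - spin σ i := by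
      intro i
      rw [eq_sub_iff_add_eq, totalSpin, ← Finset.sum_compl_add_sum {i}]
      simp
    simp only [← Finset.sum_mul, h3, sub_mul, spin_mul_self]
    rw [Finset.sum_sub_distrib, ← Finset.mul_sum, sq]
    simp [totalSpin]
  simp only [← Finset.mul_sum] at h ⊢
  rw [h2] at h
  linarith

theorem weight_critical {n : ℕ} (hn : 1 ≤ n) (σ : Config n) :
    weight 1 0 σ = Real.exp (-(1 / 2)) * Real.exp (totalSpin σ ^ 2 / (2 * n)) := by
  have hn0 : (0 : ℝ) < n := by exact_mod_cast hn
  rw [weight, sum_pairs_eq, ← Real.exp_add]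
  congr 1
  field_simp
  ring

theorem W_eq {n : ℕ} (σ : Config n) : W σ = totalSpin σ * scale n ^ 3 := by
  rw [scale_cube, W, div_eq_mul_inv]

/-- Numerator and partition function share the factor `exp (-(1 / 2)) * centralFactor n`, which
cancels; the value of `centralFactor` is therefore never needed. -/
theorem criticalGibbs_eq {n : ℕ} (hn : 1 ≤ n) (p : ℝ → Prop) [DecidablePred p] :
    criticalGibbs n {σ | p (W σ)} =
      (∑ k ∈ Finset.range (n + 1), if p (node n k) then level n k else 0) /
        ∑ k ∈ Finset.range (n + 1), level n k := by
  have hc := centralFactor_pos n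
  have key : ∀ (q : ℝ → Prop) [DecidablePred q],
      ∑ σ : Config n, (if q (W σ) then weight 1 0 σ else 0) =
      Real.exp (-(1 / 2)) * centralFactor n *
        ∑ k ∈ Finset.range (n + 1), if q (node n k) then level n k else 0 := by
    intro q _
    have h := sum_config n (fun S => if q (S * scale n ^ 3) then
      Real.exp (-(1 / 2)) * Real.exp (S ^ 2 / (2 * n)) else 0)
    simp only [W_eq, weight_critical hn]
    rw [h, Finset.mul_sum]
    refine Finset.sum_congr rfl fun k _ => ?_
    rw [node, level]
    split_ifs
    · field_simp
    · simp
  have hZ : partitionFunction 1 0 n = Real.exp (-(1 / 2)) * centralFactor n *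
      ∑ k ∈ Finset.range (n + 1), level n k := by
    have := key (fun _ => True)
    simpa [partitionFunction] using this
  have hN := key p
  have : criticalGibbs n {σ | p (W σ)} = (partitionFunction 1 0 n)⁻¹ *
      ∑ σ : Config n, (if p (W σ) then weight 1 0 σ else 0) := by
    rw [criticalGibbs, gibbs, Finset.mul_sum]
    refine Finset.sum_congr rfl fun σ _ => ?_
    by_cases hp : p (W σ)
    · rw [indicator_of_mem (by exact hp), if_pos hp]
    · rw [indicator_of_notMem (by exact hp), if_neg hp, mul_zero]
  rw [this, hN, hZ, inv_mul_eq_div, mul_div_mul_left _ _ (by positivity)]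

/-! ### Integrability and tail estimates for `p₁` -/

theorem continuous_p₁ : Continuous p₁ := by unfold p₁; fun_prop

/-- Half of the exponent absorbs the polynomial, and (t^2 - 12)^2 ≥ 0 bounds the other half by a
Gaussian. -/
theorem integrable_poly_mul_p₁ : Integrable fun t => (1 + t ^ 6) * p₁ t := by
  have hg := (integrable_exp_neg_mul_sq (one_pos : (0 : ℝ) < 1)).const_mul (1154 * Real.exp 6)
  refine hg.mono' (by have := continuous_p₁; fun_prop) (Eventually.of_forall fun t => ?_)
  -- 1154 = 2 + 2 * 24^2, from 1 + t^6 ≤ 2 + t^8 and y^2 / 2 ≤ exp y at y = t^4 / 24.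
  have h1 : 1 + t ^ 6 ≤ 1154 * Real.exp (t ^ 4 / 24) := by
    have h2 := Real.quadratic_le_exp_of_nonneg (by positivity : 0 ≤ t ^ 4 / 24)
    have h3 : t ^ 6 ≤ 1 + t ^ 8 := by
      nlinarith [sq_nonneg (t ^ 4 - t ^ 2), sq_nonneg (t ^ 2 - 1), sq_nonneg (t ^ 4),
        sq_nonneg (t ^ 2), sq_nonneg (t ^ 4 - 1)]
    have h4 : (t ^ 4 / 24) ^ 2 = t ^ 8 / 576 := by ring
    have h5 : 0 ≤ t ^ 8 := by positivity
    have h6 : 0 ≤ t ^ 4 := by positivity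
    rw [h4] at h2
    linarith
  rw [Real.norm_of_nonneg (mul_nonneg (by positivity) (p₁_pos t).le), mul_assoc, ← Real.exp_add]
  calc (1 + t ^ 6) * p₁ t ≤ 1154 * Real.exp (t ^ 4 / 24) * p₁ t := by
        have := p₁_pos t
        gcongr
    _ = 1154 * Real.exp (-(t ^ 4 / 24)) := by
        rw [p₁, mul_assoc, ← Real.exp_add]; congr 2; ring
    _ ≤ _ := by
        gcongr
        nlinarith [sq_nonneg (t ^ 2 - 12)]

theorem integrable_p₁ : Integrable p₁ := by
  refine integrable_poly_mul_p₁.mono' continuous_p₁.aestronglyMeasurable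
    (Eventually.of_forall fun t => ?_)
  rw [Real.norm_of_nonneg (p₁_pos t).le]
  exact le_mul_of_one_le_left (p₁_pos t).le (by have : 0 ≤ t ^ 6 := by positivity
                                                linarith)

theorem pow_le_one_add_pow_six {t : ℝ} {k : ℕ} (hk : k ≤ 6) : |t| ^ k ≤ 1 + t ^ 6 := by
  rw [← Even.pow_abs (by decide : Even 6) t]
  rcases le_total |t| 1 with h | h
  · have := pow_le_one₀ (n := k) (abs_nonneg t) h
    have : 0 ≤ |t| ^ 6 := by positivity
    linarith
  · have := pow_le_pow_right₀ h hk
    linarith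

theorem integrable_pow_mul_p₁ {k : ℕ} (hk : k ≤ 6) : Integrable fun t => t ^ k * p₁ t := by
  refine integrable_poly_mul_p₁.mono' (by have := continuous_p₁; fun_prop)
    (Eventually.of_forall fun t => ?_)
  rw [norm_mul, Real.norm_of_nonneg (p₁_pos t).le, norm_pow, Real.norm_eq_abs]
  have := p₁_pos t
  gcongr
  exact pow_le_one_add_pow_six hk

theorem setIntegral_Ioi_p₁_pos (x : ℝ) : 0 < ∫ t in Ioi x, p₁ t := by
  rw [setIntegral_pos_iff_support_of_nonneg_ae
    (Eventually.of_forall fun t => (p₁_pos t).le) integrable_p₁.integrableOn]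
  have : Function.support p₁ = univ := by
    ext t; simp [(p₁_pos t).ne']
  rw [this, univ_inter]
  simp

theorem integral_p₁_pos : 0 < ∫ t, p₁ t :=
  (setIntegral_Ioi_p₁_pos 0).trans_le
    (setIntegral_le_integral integrable_p₁ (Eventually.of_forall fun t => (p₁_pos t).le))

/-- Over an interval of length (1 + x)^(-3) starting at x, t^4 grows by at most 4, so `p₁` loses at
most a factor e^(1/3) ≤ 2; that interval alone gives the bound. -/
theorem p₁_le_mul_tail {x : ℝ} (hx : 0 ≤ x) : p₁ x ≤ 2 * (1 + x) ^ 3 * ∫ t in Ioi x, p₁ t := by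
  set δ := 1 / (1 + x) ^ 3 with hδ
  have hδ0 : 0 < δ := by positivity
  have hδ1 : δ ≤ 1 := by
    rw [hδ, div_le_one (by positivity)]; exact one_le_pow₀ (by linarith)
  have hd : δ * (1 + x) ^ 3 = 1 := by rw [hδ]; field_simp
  have h1 : δ * p₁ (x + δ) ≤ ∫ t in Ioi x, p₁ t := by
    calc δ * p₁ (x + δ) = ∫ t in Ioc x (x + δ), p₁ (x + δ) := by
          rw [setIntegral_const, Real.volume_real_Ioc_of_le (by linarith), smul_eq_mul]
          ring
      _ ≤ ∫ t in Ioc x (x + δ), p₁ t := by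
          refine setIntegral_mono_on (integrableOn_const measure_Ioc_lt_top.ne)
            integrable_p₁.integrableOn measurableSet_Ioc fun t ht => ?_
          unfold p₁
          have : 0 ≤ t := hx.trans ht.1.le
          have := ht.2
          gcongr
      _ ≤ _ := setIntegral_mono_set integrable_p₁.integrableOn
          (Eventually.of_forall fun t => (p₁_pos t).le) Ioc_subset_Ioi_self.eventuallyLE
  have h2 : p₁ x ≤ 2 * p₁ (x + δ) := by
    have h3 : (x + δ) ^ 4 - x ^ 4 ≤ 4 := by
      have := abs_pow_four_sub_le (t := x + δ) (s := x) (e := δ) (w := 1 + x)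
        (by rw [add_sub_cancel_left, abs_of_pos hδ0])
        (by rw [abs_of_nonneg hx]; linarith)
        (by rw [abs_of_nonneg (by linarith)]; linarith)
      rw [mul_assoc, hd] at this
      linarith [le_abs_self ((x + δ) ^ 4 - x ^ 4)]
    have h4 : Real.exp (1 / 3) ≤ 2 := by
      have := Real.exp_one_lt_d9
      have h5 : Real.exp (1 / 3) ^ 3 = Real.exp 1 := by
        rw [← Real.exp_nat_mul]; norm_num
      by_contra! hlt
      have : (2 : ℝ) ^ 3 < Real.exp (1 / 3) ^ 3 := by gcongr
      linarith
    calc p₁ x ≤ Real.exp (1 / 3) * p₁ (x + δ) := by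
          unfold p₁
          rw [← Real.exp_add]
          gcongr
          linarith
      _ ≤ _ := by
          have := p₁_pos (x + δ)
          gcongr
  calc p₁ x ≤ 2 * p₁ (x + δ) := h2
    _ = 2 * (1 + x) ^ 3 * (δ * p₁ (x + δ)) := by
        linear_combination (-2) * p₁ (x + δ) * hd
    _ ≤ _ := by gcongr

theorem hasDerivAt_cube_mul_p₁ (t : ℝ) :
    HasDerivAt (fun t => t ^ 3 * p₁ t) (3 * (t ^ 2 * p₁ t) - t ^ 6 * p₁ t / 3) t := by
  have h1 : HasDerivAt (fun t : ℝ => -(t ^ 4 / 12)) (-(4 * t ^ 3 / 12)) t := by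
    have := ((hasDerivAt_pow 4 t).div_const 12).fun_neg
    simpa using this
  refine ((hasDerivAt_pow 3 t).fun_mul h1.exp).congr_deriv ?_
  rw [p₁]
  push_cast
  ring

/-- Integrating the derivative of t^3 `p₁` trades t^6 for a lower power and the boundary term x^3
`p₁ x`, which `p₁_le_mul_tail` compares with the tail. The constant is 8780 = 6 * 2 * 729 + 32. -/
theorem setIntegral_poly_mul_p₁_le {x : ℝ} (hx : 0 ≤ x) :
    ∫ t in Ioi x, (1 + t ^ 6) * p₁ t ≤ 8780 * (1 + x ^ 6) * ∫ t in Ioi x, p₁ t := by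
  have hi2 := (integrable_pow_mul_p₁ (k := 2) (by norm_num)).integrableOn (s := Ioi x)
  have hi6 := (integrable_pow_mul_p₁ (k := 6) (by norm_num)).integrableOn (s := Ioi x)
  have hi3 := (integrable_pow_mul_p₁ (k := 3) (by norm_num)).integrableOn (s := Ioi x)
  have hi0 := integrable_p₁.integrableOn (s := Ioi x)
  have hd : IntegrableOn (fun t => 3 * (t ^ 2 * p₁ t) - t ^ 6 * p₁ t / 3) (Ioi x) :=
    (hi2.const_mul 3).sub (hi6.div_const 3)
  have hFTC := integral_Ioi_of_hasDerivAt_of_tendsto' (a := x)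
    (fun t _ => hasDerivAt_cube_mul_p₁ t) hd
    (tendsto_zero_of_hasDerivAt_of_integrableOn_Ioi (fun t _ => hasDerivAt_cube_mul_p₁ t) hd hi3)
  set a := ∫ t in Ioi x, p₁ t with ha
  have ha0 : 0 < a := setIntegral_Ioi_p₁_pos x
  -- The factor -6 turns the derivative into (2 t^6 - 18 t^2) `p₁`; adding 32 makes it dominate
  -- because t^6 - 18 t^2 + 31 ≥ 0.
  have h1 : ∫ t in Ioi x, (1 + t ^ 6) * p₁ t ≤
      ∫ t in Ioi x, (-6 * (3 * (t ^ 2 * p₁ t) - t ^ 6 * p₁ t / 3) + 32 * p₁ t) := by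
    refine setIntegral_mono integrable_poly_mul_p₁.integrableOn
      ((hd.const_mul (-6)).add (hi0.const_mul 32)) fun t => ?_
    have h2 : 0 ≤ (t ^ 6 - 18 * t ^ 2 + 31) := by
      nlinarith [mul_nonneg (sq_nonneg t) (sq_nonneg (t ^ 2 - 5 / 2)), sq_nonneg (t ^ 2 - 5 / 2)]
    have := mul_nonneg h2 (p₁_pos t).le
    simp only
    linarith
  rw [integral_add (hd.const_mul (-6)) (hi0.const_mul 32), integral_const_mul, integral_const_mul,
    hFTC, ← ha] at h1
  have h3 := p₁_le_mul_tail hx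
  rw [← ha] at h3
  have h4 : x ^ 3 * (1 + x) ^ 3 ≤ 729 * (1 + x ^ 6) := by
    refine le_trans ?_ (add_two_pow_six_le hx)
    calc x ^ 3 * (1 + x) ^ 3 ≤ (x + 2) ^ 3 * (x + 2) ^ 3 := by gcongr ?_ ^ 3 * ?_ ^ 3 <;> linarith
      _ = _ := by ring
  have h5 : x ^ 3 * p₁ x ≤ 2 * (729 * (1 + x ^ 6)) * a := by
    calc x ^ 3 * p₁ x ≤ x ^ 3 * (2 * (1 + x) ^ 3 * a) := by gcongr
      _ = 2 * (x ^ 3 * (1 + x) ^ 3) * a := by ring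
      _ ≤ _ := by gcongr
  have h6 : 0 ≤ x ^ 6 * a := by positivity
  linarith

/-! ### Tail sums against tail integrals -/

/-- The Riemann sum of `level` over the nodes to the right of `x`. -/
noncomputable def tailSum (n : ℕ) (x : ℝ) : ℝ :=
  2 * scale n ^ 3 * ∑ k ∈ Finset.range (n + 1), if x < node n k then level n k else 0

theorem criticalGibbs_gt {n : ℕ} (hn : 1 ≤ n) (x : ℝ) :
    criticalGibbs n {σ | x < W σ} = tailSum n x / ∫ t, density n t := by
  have hz := scale_pos hn
  rw [criticalGibbs_eq hn (fun w => x < w), integral_density n hz.le, tailSum,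
    mul_div_mul_left _ _ (by positivity)]

theorem integral_density_pos {n : ℕ} (hn : 1 ≤ n) : 0 < ∫ t, density n t := by
  have hz := scale_pos hn
  rw [integral_density n hz.le]
  refine mul_pos (by positivity) (Finset.sum_pos (fun k hk => ?_) ⟨0, by simp⟩)
  have : 0 < n.choose k := Nat.choose_pos (by simpa [Nat.lt_succ_iff] using hk)
  exact div_pos (by positivity) (centralFactor_pos n)

theorem tailSum_nonneg {n : ℕ} (hn : 1 ≤ n) (x : ℝ) : 0 ≤ tailSum n x := by
  have hz := scale_pos hn
  refine mul_nonneg (by positivity) (Finset.sum_nonneg fun k _ => ?_)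
  split_ifs
  exacts [level_nonneg n k, le_rfl]

theorem tailSum_le {n : ℕ} (hn : 1 ≤ n) (x : ℝ) : tailSum n x ≤ ∫ t, density n t := by
  have hz := scale_pos hn
  rw [integral_density n hz.le, tailSum]
  gcongr with k _
  split_ifs
  exacts [le_rfl, level_nonneg n k]

theorem criticalGibbs_le {n : ℕ} (hn : 1 ≤ n) (x : ℝ) :
    criticalGibbs n {σ | W σ ≤ x} = 1 - tailSum n x / ∫ t, density n t := by
  have hz := scale_pos hn
  have hpos := integral_density_pos hn
  rw [criticalGibbs_eq hn (fun w => w ≤ x), eq_sub_iff_add_eq, tailSum]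
  rw [integral_density n hz.le] at hpos ⊢
  rw [mul_div_mul_left _ _ (by positivity), ← add_div, ← Finset.sum_add_distrib]
  have : ∀ k, ((if node n k ≤ x then level n k else 0) + if x < node n k then level n k else 0)
      = level n k := by
    intro k
    by_cases h : x < node n k
    · simp [h, not_le.2 h]
    · simp [h, not_lt.1 h]
  simp only [this]
  exact div_self (pos_of_mul_pos_right hpos (by positivity)).ne'

theorem abs_setIntegral_density_sub_p₁_le {n : ℕ} (hn : 1 ≤ n) (s : Set ℝ) :
    |(∫ t in s, density n t) - ∫ t in s, p₁ t| ≤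
      profileConst * scale n ^ 2 * ∫ t in s, (1 + t ^ 6) * p₁ t := by
  rw [← integral_sub (integrable_density n).integrableOn integrable_p₁.integrableOn,
    ← integral_const_mul, ← Real.norm_eq_abs]
  exact norm_integral_le_of_norm_le (integrable_poly_mul_p₁.integrableOn.const_mul _)
    (Eventually.of_forall fun t =>
      (isLocalProfile_density hn t).abs_sub_le (scale_pos hn) (scale_le_one hn))

theorem density_le {n : ℕ} (hn : 1 ≤ n) (t : ℝ) : density n t ≤ Real.exp 20 * p₁ t :=
  ((isLocalProfile_density hn t).bounds (scale_pos hn) (scale_le_one hn)).2.1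

theorem abs_setIntegral_density_sub_tailSum_le {n : ℕ} (hn : 1 ≤ n) (x : ℝ) :
    |(∫ t in Ioi x, density n t) - tailSum n x| ≤ 2 * scale n ^ 3 * (Real.exp 20 * p₁ x) := by
  have hz := scale_pos hn
  refine (abs_setIntegral_density_sub_le n hz.le x).trans ?_
  gcongr
  exact density_le hn x

/-- Two errors add up: the boundary cell, of order z^3 `p₁ x`, and the integrated distance between
`density` and `p₁`. Both are at most z^2 (1 + x^6) times the tail, up to constants. -/
theorem exists_abs_tailSum_sub_le : ∃ C : ℝ, 0 < C ∧ ∀ n : ℕ, 1 ≤ n → ∀ x : ℝ, 0 ≤ x →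
    |tailSum n x - ∫ t in Ioi x, p₁ t| ≤
      C * scale n ^ 2 * ((1 + x ^ 6) * ∫ t in Ioi x, p₁ t) := by
  have hK := profileConst_pos
  refine ⟨2916 * Real.exp 20 + 8780 * profileConst, by positivity, fun n hn x hx => ?_⟩
  have hz := scale_pos hn
  have hz32 : scale n ^ 3 ≤ scale n ^ 2 :=
    pow_le_pow_of_le_one hz.le (scale_le_one hn) (by norm_num)
  have h1 := abs_setIntegral_density_sub_tailSum_le hn x
  have h2 := abs_setIntegral_density_sub_p₁_le hn (Ioi x)
  have h3 := setIntegral_poly_mul_p₁_le hx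
  have h4 := p₁_le_mul_tail hx
  have ha := setIntegral_Ioi_p₁_pos x
  set a := ∫ t in Ioi x, p₁ t
  have h5 : (1 + x) ^ 3 ≤ 729 * (1 + x ^ 6) := by
    refine le_trans ?_ (add_two_pow_six_le hx)
    calc (1 + x) ^ 3 ≤ (x + 2) ^ 3 := by gcongr ?_ ^ 3; linarith
      _ ≤ (x + 2) ^ 6 := pow_le_pow_right₀ (by linarith) (by norm_num)
  have hp := (p₁_pos x).le
  have h6 : 2 * scale n ^ 3 * (Real.exp 20 * p₁ x) ≤
      2916 * Real.exp 20 * scale n ^ 2 * ((1 + x ^ 6) * a) := by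
    calc 2 * scale n ^ 3 * (Real.exp 20 * p₁ x)
        ≤ 2 * scale n ^ 2 * (Real.exp 20 * (2 * (729 * (1 + x ^ 6)) * a)) := by
          gcongr
          exact h4.trans (by gcongr)
      _ = _ := by ring
  have h7 : profileConst * scale n ^ 2 * ∫ t in Ioi x, (1 + t ^ 6) * p₁ t ≤
      8780 * profileConst * scale n ^ 2 * ((1 + x ^ 6) * a) := by
    calc _ ≤ profileConst * scale n ^ 2 * (8780 * (1 + x ^ 6) * a) := by gcongr
      _ = _ := by ring
  rw [abs_le] at h1 h2 ⊢
  rw [add_mul, add_mul]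
  constructor <;> linarith [h1.1, h1.2, h2.1, h2.2]

theorem tendsto_setIntegral_density (s : Set ℝ) :
    Tendsto (fun n => ((∫ t in s, density n t) - ∫ t in s, p₁ t) / scale n ^ 2) atTop
      (𝓝 (∫ t in s, p₂ t)) := by
  have hev : ∀ᶠ n : ℕ in atTop, 1 ≤ n := eventually_ge_atTop 1
  have h := tendsto_integral_filter_of_dominated_convergence (μ := volume.restrict s)
    (F := fun n t => (density n t - p₁ t) / scale n ^ 2) (f := p₂) (l := atTop)
    (fun t => profileConst * ((1 + t ^ 6) * p₁ t))
    (Eventually.of_forall fun n => (((integrable_density n).sub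
      integrable_p₁).div_const _).integrableOn.aestronglyMeasurable)
    (hev.mono fun n hn => Eventually.of_forall fun t => ?_)
    (integrable_poly_mul_p₁.integrableOn.const_mul _)
    (Eventually.of_forall fun t => tendsto_of_isLocalProfile tendsto_scale
      (hev.mono fun n hn => scale_pos hn) (hev.mono fun n hn => isLocalProfile_density hn t))
  · refine h.congr fun n => ?_
    rw [integral_div, integral_sub (integrable_density n).integrableOn integrable_p₁.integrableOn]
  · have hz := scale_pos hn
    have hz2 : 0 < scale n ^ 2 := by positivity
    rw [norm_div, Real.norm_of_nonneg hz2.le, div_le_iff₀ hz2]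
    refine ((isLocalProfile_density hn t).abs_sub_le hz (scale_le_one hn)).trans_eq ?_
    ring

/-- The boundary cell costs order z^3, invisible after division by z^2. -/
theorem tendsto_tailSum (x : ℝ) :
    Tendsto (fun n => (tailSum n x - ∫ t in Ioi x, p₁ t) / scale n ^ 2) atTop
      (𝓝 (∫ t in Ioi x, p₂ t)) := by
  have h0 : Tendsto (fun n => ((∫ t in Ioi x, density n t) - tailSum n x) / scale n ^ 2) atTop
      (𝓝 0) := by
    have hb : Tendsto (fun n => 2 * scale n * (Real.exp 20 * p₁ x)) atTop (𝓝 0) := by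
      simpa using (tendsto_scale.const_mul 2).mul_const (Real.exp 20 * p₁ x)
    refine squeeze_zero_norm' ?_ hb
    filter_upwards [eventually_ge_atTop 1] with n hn
    have hz := scale_pos hn
    have hz2 : 0 < scale n ^ 2 := by positivity
    rw [norm_div, Real.norm_of_nonneg hz2.le, div_le_iff₀ hz2]
    refine (abs_setIntegral_density_sub_tailSum_le hn x).trans_eq ?_
    ring
  have := (tendsto_setIntegral_density (Ioi x)).sub h0
  rw [sub_zero] at this
  refine this.congr fun n => ?_
  ring

/-! ### The limit and the relative error bound -/

theorem one_sub_F (x : ℝ) : 1 - F x = (∫ t in Ioi x, p₁ t) / ∫ t, p₁ t := by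
  have h := integral_add_compl (s := Iic x) measurableSet_Iic integrable_p₁
  rw [compl_Iic] at h
  have hA := integral_p₁_pos
  rw [F, eq_div_iff hA.ne', sub_mul, div_mul_cancel₀ _ hA.ne']
  linarith

theorem sqrt_eq_inv_scale_sq (n : ℕ) : √(n : ℝ) = (scale n ^ 2)⁻¹ := by
  rw [scale_sq, inv_inv]

/-- With a, A the tail and total integrals of `p₁` and τ, T their discrete counterparts, the
difference of distribution functions is a/A - τ/T = (a (T - A) - A (τ - a)) / (A T), and each
bracket has a known first-order limit. -/
theorem tendsto_sqrt_mul_criticalGibbs_sub (x : ℝ) :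
    Tendsto (fun n : ℕ => √(n : ℝ) * (criticalGibbs n {σ | W σ ≤ x} - F x)) atTop
      (𝓝 ((F x - 1) * G x)) := by
  have hA := integral_p₁_pos
  have ha := setIntegral_Ioi_p₁_pos x
  have hT := tendsto_tailSum x
  have hD := tendsto_setIntegral_density univ
  simp only [setIntegral_univ] at hD
  have hF := one_sub_F x
  have hG : G x = (∫ t in Ioi x, p₂ t) / (∫ t in Ioi x, p₁ t) - (∫ t, p₂ t) / ∫ t, p₁ t := rfl
  set A := ∫ t, p₁ t
  set a := ∫ t in Ioi x, p₁ t
  set B := ∫ t, p₂ t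
  set b := ∫ t in Ioi x, p₂ t
  have hDA : Tendsto (fun n => ∫ t, density n t) atTop (𝓝 A) := by
    have h1 := (hD.mul (tendsto_scale.pow 2)).add_const A
    rw [zero_pow two_ne_zero, mul_zero, zero_add] at h1
    refine h1.congr' ?_
    filter_upwards [eventually_ge_atTop 1] with n hn
    have hz := scale_pos hn
    field_simp
    ring
  have hlim := ((hD.const_mul a).sub (hT.const_mul A)).div (hDA.const_mul A)
    (mul_pos hA hA).ne'
  have e : (F x - 1) * G x = (a * B - A * b) / (A * A) := by
    have : F x - 1 = -(a / A) := by linarith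
    rw [this, hG]
    field_simp
    ring
  rw [e]
  refine hlim.congr' ?_
  filter_upwards [eventually_ge_atTop 1] with n hn
  have hz := scale_pos hn
  have hpos := integral_density_pos hn
  have hF' : F x = 1 - a / A := by linarith
  rw [criticalGibbs_le hn, hF', sqrt_eq_inv_scale_sq, Pi.div_apply]
  field_simp
  ring

/-- If the discrete mass T is at least A/2, the relative errors of tail and mass combine directly.
Otherwise n is bounded, hence so is x, and a trivial bound on the ratio is absorbed into the
constant. -/
theorem exists_abs_criticalGibbs_div_sub_one_le :
    ∃ C : ℝ, 0 < C ∧ ∀ n : ℕ, 1 ≤ n → ∀ x : ℝ, 0 ≤ x → x ≤ (n : ℝ) ^ ((1 : ℝ) / 12) →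
      |criticalGibbs n {σ | x < W σ} / (1 - F x) - 1| ≤ C * ((1 + x ^ 6) / √(n : ℝ)) := by
  obtain ⟨C₁, hC₁, hT⟩ := exists_abs_tailSum_sub_le
  have hA := integral_p₁_pos
  have hK := profileConst_pos
  set A := ∫ t, p₁ t with hAdef
  set M := ∫ t, (1 + t ^ 6) * p₁ t with hM
  have hM0 : 0 < M := hA.trans_le (integral_mono integrable_p₁ integrable_poly_mul_p₁ fun t =>
    le_mul_of_one_le_left (p₁_pos t).le (by have : 0 ≤ t ^ 6 := by positivity
                                            linarith))
  -- T < A/2 forces an error above A/2 in the total mass, hence z^2 ≥ η, that is n ≤ 1/η^2.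
  set η := A / (2 * profileConst * M) with hη
  have hη0 : 0 < η := by positivity
  set a₀ := ∫ t in Ioi (max 1 (1 / η ^ 2)), p₁ t with ha₀
  have ha₀0 : 0 < a₀ := setIntegral_Ioi_p₁_pos _
  refine ⟨2 * (C₁ + profileConst * M / A) + (A / a₀ + 1) / η, by positivity,
    fun n hn x hx hxn => ?_⟩
  have hz := scale_pos hn
  have hz2 : 0 < scale n ^ 2 := by positivity
  have hTx := hT n hn x hx
  have hD := abs_setIntegral_density_sub_p₁_le hn univ
  simp only [setIntegral_univ] at hD
  rw [← hAdef, ← hM] at hD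
  have ha := setIntegral_Ioi_p₁_pos x
  have hpos := integral_density_pos hn
  rw [criticalGibbs_gt hn, one_sub_F, div_eq_mul_inv (1 + x ^ 6), ← scale_sq, ← hAdef]
  have hts0 := tailSum_nonneg hn x
  have hts1 := tailSum_le hn x
  set T := ∫ t, density n t
  set τ := tailSum n x
  set a := ∫ t in Ioi x, p₁ t with hadef
  have hx6 : 0 ≤ x ^ 6 := by positivity
  have hx61 : 1 ≤ 1 + x ^ 6 := by linarith
  have e : τ / T / (a / A) - 1 = ((τ - a) * A + a * (A - T)) / (a * T) := by
    field_simp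
    ring
  clear_value A M η a₀ T τ a
  rcases le_or_gt (A / 2) T with hTA | hTA
  · have h1 : |(τ - a) * A + a * (A - T)| ≤
        a * (A / 2) * (2 * (C₁ + profileConst * M / A) * ((1 + x ^ 6) * scale n ^ 2)) := by
      calc |(τ - a) * A + a * (A - T)| ≤ |τ - a| * A + a * |T - A| := by
            refine (abs_add_le _ _).trans_eq ?_
            rw [abs_mul, abs_mul, abs_of_pos hA, abs_of_pos ha, abs_sub_comm A T]
        _ ≤ C₁ * scale n ^ 2 * ((1 + x ^ 6) * a) * A
            + a * (profileConst * scale n ^ 2 * M) := by gcongr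
        _ ≤ C₁ * scale n ^ 2 * ((1 + x ^ 6) * a) * A
            + a * (profileConst * scale n ^ 2 * M) * (1 + x ^ 6) :=
            add_le_add le_rfl (le_mul_of_one_le_right (by positivity) hx61)
        _ = _ := by field_simp
    have h2 : |τ / T / (a / A) - 1| ≤
        2 * (C₁ + profileConst * M / A) * ((1 + x ^ 6) * scale n ^ 2) := by
      rw [e, abs_div, abs_of_pos (mul_pos ha hpos), div_le_iff₀ (mul_pos ha hpos)]
      refine h1.trans ?_
      rw [mul_comm]
      gcongr
    refine h2.trans ?_
    gcongr
    have : 0 < (A / a₀ + 1) / η := by positivity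
    linarith
  · have h1 : η ≤ scale n ^ 2 := by
      rw [hη, div_le_iff₀ (by positivity)]
      have := neg_le_abs (T - A)
      linarith
    have hn0 : (1 : ℝ) ≤ n := by exact_mod_cast hn
    -- The range condition on x is needed only here: it turns the bound on n into one on x, keeping
    -- the tail of `p₁` above a₀.
    have h2 : x ≤ max 1 (1 / η ^ 2) := by
      refine le_max_of_le_right (hxn.trans ?_)
      calc (n : ℝ) ^ ((1 : ℝ) / 12) ≤ (n : ℝ) ^ (1 : ℝ) :=
            Real.rpow_le_rpow_of_exponent_le hn0 (by norm_num)
        _ = n := Real.rpow_one _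
        _ = 1 / (scale n ^ 2) ^ 2 := by
            rw [← pow_mul, scale_pow_four]; simp
        _ ≤ 1 / η ^ 2 := by gcongr
    have h3 : a₀ ≤ a := by
      rw [ha₀, hadef]
      exact setIntegral_mono_set integrable_p₁.integrableOn
        (Eventually.of_forall fun t => (p₁_pos t).le) (Ioi_subset_Ioi h2).eventuallyLE
    have h4 : τ / T / (a / A) ≤ A / a₀ := by
      have h5 : τ / T ≤ 1 := (div_le_one hpos).2 hts1
      calc τ / T / (a / A) ≤ 1 / (a / A) := by gcongr
        _ = A / a := by rw [one_div_div]
        _ ≤ _ := by gcongr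
    have h5 : 0 ≤ τ / T / (a / A) := by positivity
    have h6 : |τ / T / (a / A) - 1| ≤ A / a₀ + 1 := by
      have : 0 < A / a₀ := by positivity
      rw [abs_le]
      constructor <;> linarith
    calc |τ / T / (a / A) - 1| ≤ A / a₀ + 1 := h6
      _ = (A / a₀ + 1) / η * (1 * η) := by field_simp
      _ ≤ (A / a₀ + 1) / η * ((1 + x ^ 6) * scale n ^ 2) := by gcongr
      _ ≤ _ := by
        gcongr
        have : 0 < 2 * (C₁ + profileConst * M / A) := by positivity
        linarith

end CurieWeiss

theorem corollary1p5 :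
    (∃ C : ℝ, 0 < C ∧ ∀ n : ℕ, 1 ≤ n → ∀ x : ℝ, 0 ≤ x → x ≤ (n : ℝ) ^ ((1 : ℝ) / 12) →
      |CurieWeiss.criticalGibbs n {σ | x < CurieWeiss.W σ} / (1 - CurieWeiss.F x) - 1|
        ≤ C * ((1 + x ^ 6) / √(n : ℝ))) ∧
    (∀ x : ℝ, Tendsto
      (fun n : ℕ => √(n : ℝ) *
        (CurieWeiss.criticalGibbs n {σ | CurieWeiss.W σ ≤ x} - CurieWeiss.F x))
      atTop (𝓝 ((CurieWeiss.F x - 1) * CurieWeiss.G x))) :=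
  ⟨CurieWeiss.exists_abs_criticalGibbs_div_sub_one_le,
    CurieWeiss.tendsto_sqrt_mul_criticalGibbs_sub⟩
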